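/- Let $m$ be an indeterminate and $K=\mathbb{Q}(m)$. Consider the equation $$(x_1^5+x_2^5)(x_3^5+x_4^5)=(y_1^5+y_2^5)(y_3^5+y_4^5).\qquad(1)$$ A solution is called trivial if it also satisfies the equation obtained from (1) by replacing the exponent $5$ by $k$, for every odd positive integer $k$, or if both sides of (1) are $0$. Put $$\begin{aligned}\phi(u)={}&(m^6-26m^4-31m^2-8)(m+1)^2u^4-4m(m+1)(m^2+3)(m^4-6m^2-3)u^3\\&+2(m-1)(m+1)(3m^6+28m^4+31m^2+2)u^2\\&-4m(m-1)(m^2+3)(m^4+6m^2+1)u+m^2(m+1)^2(m-1)^4,\end{aligned}$$ and let $E$ be the cubic curve $$\begin{aligned}V^2={}&U^3-432(m-1)(m+1)(325m^{10}+955m^8+1266m^6+470m^4+57m^2-1)U\\&-3456(5m^4+2m^2+1)(875m^{10}+2885m^8+3822m^6+1450m^4+183m^2+1)(m-1)^2(m+1)^2.\end{aligned}$$ (a) $E$ is an elliptic curve over $K$, and the quartic curve $v^2=\phi(u)$ is birationally equivalent to $E$ over $K$: the following formulas define mutually inverse birational maps (that is, mutually inverse $K$-isomorphisms of the function fields). $$\begin{aligned}u={}&6m(m-1)\{(m+1)^2(m-1)^2U-420m^{10}-4812m^8-12648m^6-14232m^4-4404m^2-348\}/\psi,\\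 v={}&m(m-1)\{2(m+1)^3(m-1)^3U^3\\&-36(m-1)(m+1)(35m^{10}+401m^8+1054m^6+1186m^4+367m^2+29)U^2-(m^2-1)^3V^2\\&-864(3m^2+1)(m^2+3)(5m^4+10m^2+1)(7m^6+23m^4+29m^2+5)V\\&+1728(m^2-1)^2(42875m^{20}+497350m^{18}+2290155m^{16}+5717736m^{14}+8360982m^{12}\\&+7151748m^{10}+3327950m^8+821800m^6+97551m^4+3494m^2-89)\}/\psi^2,\end{aligned}$$ where $$\psi(U,V)=6(m^2+3)(m^4+6m^2+1)U+(m^2-1)V-72(m^2-1)(m^2+3)(35m^8+86m^6+108m^4+26m^2+1),$$ and $$\begin{aligned}U={}&\{6(m-1)(m+1)(3m^6+28m^4+31m^2+2)u^2-36m(m-1)(m^2+3)(m^4+6m^2+1)u\\&+18m(m+1)(m-1)^2v+18m^2(m+1)^2(m-1)^4\}/u^2,\\ V={}&-108m\{m(m^2+3)(m^4-6m^2-3)(m-1)^2(m+1)^2u^3-(3m^6+28m^4+31m^2+2)(m+1)^2(m-1)^3u^2\\&+(m-1)(m^2+3)(m^4+6m^2+1)uv+3m(m+1)(m^2+3)(m^4+6m^2+1)(m-1)^3u\\&-m(m+1)^2(m-1)^4v-m^2(m+1)^3(m-1)^6\}/u^3.\end{aligned}$$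 (b) Let $$u_0=\frac{m(m+1)^2(m-1)^3(m^2+3)(7m^6+23m^4+29m^2+5)}{2m^{14}-41m^{12}-328m^{10}-967m^8-1382m^6-1047m^4-308m^2-25}.$$ There is a point $P=(u_0,v_0)$ on the quartic over $K$ that corresponds under these maps, which are both defined there, to the point $P'=(U_0,V_0)$ of $E$, where, with $d=(m^2+3)(m-1)(m+1)(7m^6+23m^4+29m^2+5)$, $$\begin{aligned}U_0={}&12(75m^{28}+1010m^{26}+11944m^{24}+103096m^{22}+585657m^{20}+2202226m^{18}\\&+5635746m^{16}+10027936m^{14}+12482909m^{12}+10709526m^{10}+6063588m^8\\&+2067944m^6+398591m^4+39750m^2+1650)/d^2,\\ V_0={}&-216(125m^{42}+2525m^{40}+12350m^{38}-138015m^{36}-2822345m^{34}-24701264m^{32}\\&-140086792m^{30}-573149148m^{28}-1776227438m^{26}-4275792154m^{24}-8087224924m^{22}\\&-12040781858m^{20}-14031203010m^{18}-12641030116m^{16}-8645319848m^{14}\\&-4384538092m^{12}-1605427583m^{10}-411694779m^8-71091250m^6-7771895m^4\\&-478725m^2-12500)/d^3.\end{aligned}$$ The point $P'$ has infinite order in $E(K)$.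 (c) For every integer $n\neq0$ the point $nP'=(U,V)$ is affine with $\psi(U,V)\ne0$, so that the formulas in (a) give $u_n,v_n\in K$; they satisfy $v_n^2=\phi(u_n)$, and the set $\{u_n:n\ne0\}$ is infinite. (d) There is a computable sequence, indexed by $n\geq1$, of nontrivial solutions of (1) in polynomials $x_1,\dots,x_4,y_1,\dots,y_4\in\mathbb{Z}[m]$ (given by their lists of coefficients), no two of which can be transformed into each other by multiplying the pairs $(x_1,x_2)$, $(x_3,x_4)$, $(y_1,y_2)$, $(y_3,y_4)$ by nonzero elements of $K$. The $n$-th solution is obtained from $u=u_n$ in the following way: for some nonzero $S_1\in K$, put $$h=\frac{-2S_1^2u\{(m+1)(m^2+1)u-m(m^2+3)\}}{(3m^2+1)\{(m+1)u^2-m+1\}},\quad t_1=\frac{S_1^2-h}{S_1},\quad s_1=\frac{(3m^2+1)h-(m^2-1)S_1^2}{(3m^2+1)S_1},\quad T_1=s_1+t_1-S_1,$$ $$g=(s_1+t_1)(t_1-S_1)\{s_1^2+(t_1-S_1)s_1+t_1^2-t_1S_1+S_1^2\},\quad D=2h+3(s_1+t_1)(t_1-S_1),$$ $$s_2=\frac{h^2+\{s_1^2+(3t_1-2S_1)s_1+3t_1^2-3t_1S_1+S_1^2\}h+g}{D},\quad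 t_2=\frac{-h^2+(s_1^2+s_1S_1+S_1^2)h+g}{D}$$ (all denominators being nonzero); then the pairs $$(x_1x_3,\,x_2x_4),\quad(-y_1y_3,\,-y_2y_4),\quad(-x_1x_4,\,-x_2x_3),\quad(y_1y_4,\,y_2y_3)$$ have the sums $s_1,t_1,S_1,T_1$ and the products $s_2,t_2,s_2,t_2$, respectively. -/

import Mathlib

namespace FifthPowers

open Polynomial

/-! ### The diophantine equation -/

/-- `(x₁ᵏ + x₂ᵏ)(x₃ᵏ + x₄ᵏ) = (y₁ᵏ + y₂ᵏ)(y₃ᵏ + y₄ᵏ)`. -/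
def PowerEq {R : Type*} [CommRing R] (k : ℕ) (x y : Fin 4 → R) : Prop :=
  (x 0 ^ k + x 1 ^ k) * (x 2 ^ k + x 3 ^ k) = (y 0 ^ k + y 1 ^ k) * (y 2 ^ k + y 3 ^ k)

/-- A solution of the equation in fifth powers is trivial if it satisfies the corresponding
equation for every odd exponent, or if both sides of the equation are zero. -/
def IsTrivialSol {R : Type*} [CommRing R] (x y : Fin 4 → R) : Prop :=
  (∀ k : ℕ, Odd k → PowerEq k x y) ∨
    ((x 0 ^ 5 + x 1 ^ 5) * (x 2 ^ 5 + x 3 ^ 5) = 0 ∧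
      (y 0 ^ 5 + y 1 ^ 5) * (y 2 ^ 5 + y 3 ^ 5) = 0)

/-- `(x', y')` arises from `(x, y)` by rescaling each of the four pairs `(x₁, x₂)`, `(x₃, x₄)`,
`(y₁, y₂)`, `(y₃, y₄)` by a nonzero factor. -/
def ScalingEquiv {K : Type*} [Field K] (x y x' y' : Fin 4 → K) : Prop :=
  ∃ a b c d : K, a ≠ 0 ∧ b ≠ 0 ∧ c ≠ 0 ∧ d ≠ 0 ∧
    x' 0 = a * x 0 ∧ x' 1 = a * x 1 ∧ x' 2 = b * x 2 ∧ x' 3 = b * x 3 ∧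
    y' 0 = c * y 0 ∧ y' 1 = c * y 1 ∧ y' 2 = d * y 2 ∧ y' 3 = d * y 3

/-! ### The quartic, the cubic and the transformations between them

In all of these, `m` is an element of an arbitrary field; it will be the indeterminate of `ℚ(m)`,
or its image in an extension of `ℚ(m)`. -/

section Formulas

variable {L : Type*} [Field L]

/-- The coefficients of the quartic `φ`, the coefficient of `u ^ i` at the place `i`. -/
def phiCoeff (m : L) : Fin 5 → L :=
  ![m ^ 2 * (m + 1) ^ 2 * (m - 1) ^ 4,
    -4 * m * (m - 1) * (m ^ 2 + 3) * (m ^ 4 + 6 * m ^ 2 + 1),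
    2 * (m - 1) * (m + 1) * (3 * m ^ 6 + 28 * m ^ 4 + 31 * m ^ 2 + 2),
    -4 * m * (m + 1) * (m ^ 2 + 3) * (m ^ 4 - 6 * m ^ 2 - 3),
    (m ^ 6 - 26 * m ^ 4 - 31 * m ^ 2 - 8) * (m + 1) ^ 2]

/-- The value `φ(u)`. -/
def phi (m u : L) : L := ∑ i : Fin 5, phiCoeff m i * u ^ (i : ℕ)

/-- `φ` as a polynomial in `u`. -/
noncomputable def phiPoly (m : L) : L[X] := ∑ i : Fin 5, C (phiCoeff m i) * X ^ (i : ℕ)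

/-- The cubic curve `V² = U³ + A U + B`. -/
def cubic (m : L) : WeierstrassCurve L where
  a₁ := 0
  a₂ := 0
  a₃ := 0
  a₄ := -432 * (m - 1) * (m + 1) *
    (325 * m ^ 10 + 955 * m ^ 8 + 1266 * m ^ 6 + 470 * m ^ 4 + 57 * m ^ 2 - 1)
  a₆ := -3456 * (5 * m ^ 4 + 2 * m ^ 2 + 1) *
    (875 * m ^ 10 + 2885 * m ^ 8 + 3822 * m ^ 6 + 1450 * m ^ 4 + 183 * m ^ 2 + 1) *
    (m - 1) ^ 2 * (m + 1) ^ 2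

def psi (m U V : L) : L :=
  6 * (m ^ 2 + 3) * (m ^ 4 + 6 * m ^ 2 + 1) * U + (m ^ 2 - 1) * V
    - 72 * (m ^ 2 - 1) * (m ^ 2 + 3) * (35 * m ^ 8 + 86 * m ^ 6 + 108 * m ^ 4 + 26 * m ^ 2 + 1)

/-- The coordinate `u` of the point of the quartic given by `(U, V)`. -/
def uOf (m U V : L) : L :=
  6 * m * (m - 1) * ((m + 1) ^ 2 * (m - 1) ^ 2 * U - 420 * m ^ 10 - 4812 * m ^ 8
    - 12648 * m ^ 6 - 14232 * m ^ 4 - 4404 * m ^ 2 - 348) / psi m U V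

/-- The coordinate `v` of the point of the quartic given by `(U, V)`. -/
def vOf (m U V : L) : L :=
  m * (m - 1) * (2 * (m + 1) ^ 3 * (m - 1) ^ 3 * U ^ 3
    - 36 * (m - 1) * (m + 1) * (35 * m ^ 10 + 401 * m ^ 8 + 1054 * m ^ 6 + 1186 * m ^ 4
        + 367 * m ^ 2 + 29) * U ^ 2
    - (m ^ 2 - 1) ^ 3 * V ^ 2
    - 864 * (3 * m ^ 2 + 1) * (m ^ 2 + 3) * (5 * m ^ 4 + 10 * m ^ 2 + 1)
        * (7 * m ^ 6 + 23 * m ^ 4 + 29 * m ^ 2 + 5) * V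
    + 1728 * (m ^ 2 - 1) ^ 2 * (42875 * m ^ 20 + 497350 * m ^ 18 + 2290155 * m ^ 16
        + 5717736 * m ^ 14 + 8360982 * m ^ 12 + 7151748 * m ^ 10 + 3327950 * m ^ 8
        + 821800 * m ^ 6 + 97551 * m ^ 4 + 3494 * m ^ 2 - 89)) / psi m U V ^ 2

/-- The coordinate `U` of the point of the cubic given by `(u, v)`. -/
def UOf (m u v : L) : L :=
  (6 * (m - 1) * (m + 1) * (3 * m ^ 6 + 28 * m ^ 4 + 31 * m ^ 2 + 2) * u ^ 2
    - 36 * m * (m - 1) * (m ^ 2 + 3) * (m ^ 4 + 6 * m ^ 2 + 1) * u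
    + 18 * m * (m + 1) * (m - 1) ^ 2 * v + 18 * m ^ 2 * (m + 1) ^ 2 * (m - 1) ^ 4) / u ^ 2

/-- The coordinate `V` of the point of the cubic given by `(u, v)`. -/
def VOf (m u v : L) : L :=
  -108 * m * (m * (m ^ 2 + 3) * (m ^ 4 - 6 * m ^ 2 - 3) * (m - 1) ^ 2 * (m + 1) ^ 2 * u ^ 3
    - (3 * m ^ 6 + 28 * m ^ 4 + 31 * m ^ 2 + 2) * (m + 1) ^ 2 * (m - 1) ^ 3 * u ^ 2
    + (m - 1) * (m ^ 2 + 3) * (m ^ 4 + 6 * m ^ 2 + 1) * u * v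
    + 3 * m * (m + 1) * (m ^ 2 + 3) * (m ^ 4 + 6 * m ^ 2 + 1) * (m - 1) ^ 3 * u
    - m * (m + 1) ^ 2 * (m - 1) ^ 4 * v - m ^ 2 * (m + 1) ^ 3 * (m - 1) ^ 6) / u ^ 3

/-- The value of `u` that belongs to the first parametric solution. -/
def u₀ (m : L) : L :=
  m * (m + 1) ^ 2 * (m - 1) ^ 3 * (m ^ 2 + 3) * (7 * m ^ 6 + 23 * m ^ 4 + 29 * m ^ 2 + 5) /
    (2 * m ^ 14 - 41 * m ^ 12 - 328 * m ^ 10 - 967 * m ^ 8 - 1382 * m ^ 6 - 1047 * m ^ 4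
      - 308 * m ^ 2 - 25)

def den (m : L) : L :=
  (m ^ 2 + 3) * (m - 1) * (m + 1) * (7 * m ^ 6 + 23 * m ^ 4 + 29 * m ^ 2 + 5)

def U₀ (m : L) : L :=
  12 * (75 * m ^ 28 + 1010 * m ^ 26 + 11944 * m ^ 24 + 103096 * m ^ 22 + 585657 * m ^ 20
    + 2202226 * m ^ 18 + 5635746 * m ^ 16 + 10027936 * m ^ 14 + 12482909 * m ^ 12
    + 10709526 * m ^ 10 + 6063588 * m ^ 8 + 2067944 * m ^ 6 + 398591 * m ^ 4
    + 39750 * m ^ 2 + 1650) / den m ^ 2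

/-- With the leading minus sign, `(U₀, V₀)` is the point given by `(u₀, v₀)`, and at `m = 2` it
is `(3346068693496 / 43020481, 5630105905921711808 / 282171334879)`. -/
def V₀ (m : L) : L :=
  -(216 * (125 * m ^ 42 + 2525 * m ^ 40 + 12350 * m ^ 38 - 138015 * m ^ 36
    - 2822345 * m ^ 34 - 24701264 * m ^ 32 - 140086792 * m ^ 30 - 573149148 * m ^ 28
    - 1776227438 * m ^ 26 - 4275792154 * m ^ 24 - 8087224924 * m ^ 22
    - 12040781858 * m ^ 20 - 14031203010 * m ^ 18 - 12641030116 * m ^ 16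
    - 8645319848 * m ^ 14 - 4384538092 * m ^ 12 - 1605427583 * m ^ 10
    - 411694779 * m ^ 8 - 71091250 * m ^ 6 - 7771895 * m ^ 4 - 478725 * m ^ 2
    - 12500)) / den m ^ 3

/-! ### From `u` to a solution of the equation -/

def hOf (m S₁ u : L) : L :=
  -2 * S₁ ^ 2 * u * ((m + 1) * (m ^ 2 + 1) * u - m * (m ^ 2 + 3)) /
    ((3 * m ^ 2 + 1) * ((m + 1) * u ^ 2 - m + 1))

/-- `(x, y)` is a solution obtained from the value `u`, with some `S₁ ≠ 0`: with
`X₁ = x₁x₃, X₂ = x₂x₄, X₃ = -y₁y₃, X₄ = -y₂y₄, Y₁ = -x₁x₄, Y₂ = -x₂x₃, Y₃ = y₁y₄, Y₄ = y₂y₃`,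
the pairs `(X₁, X₂)`, `(X₃, X₄)`, `(Y₁, Y₂)`, `(Y₃, Y₄)` have the sums `s₁, t₁, S₁, T₁` and the
products `s₂, t₂, s₂, t₂`, where `h, s₁, t₁, T₁, s₂, t₂` are the given functions of
`m`, `u`, `S₁`. -/
def ObtainedFrom (m u : L) (x y : Fin 4 → L) : Prop :=
  ∃ S₁ h s₁ t₁ T₁ s₂ t₂ : L,
    S₁ ≠ 0 ∧ (3 * m ^ 2 + 1) * ((m + 1) * u ^ 2 - m + 1) ≠ 0 ∧
    h = hOf m S₁ u ∧
    t₁ = (S₁ ^ 2 - h) / S₁ ∧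
    s₁ = ((3 * m ^ 2 + 1) * h - (m ^ 2 - 1) * S₁ ^ 2) / ((3 * m ^ 2 + 1) * S₁) ∧
    T₁ = s₁ + t₁ - S₁ ∧
    2 * h + 3 * (s₁ + t₁) * (t₁ - S₁) ≠ 0 ∧
    s₂ = (h ^ 2 + (s₁ ^ 2 + (3 * t₁ - 2 * S₁) * s₁ + 3 * t₁ ^ 2 - 3 * t₁ * S₁ + S₁ ^ 2) * h
        + (s₁ + t₁) * (t₁ - S₁) * (s₁ ^ 2 + (t₁ - S₁) * s₁ + t₁ ^ 2 - t₁ * S₁ + S₁ ^ 2)) /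
      (2 * h + 3 * (s₁ + t₁) * (t₁ - S₁)) ∧
    t₂ = (-h ^ 2 + (s₁ ^ 2 + s₁ * S₁ + S₁ ^ 2) * h
        + (s₁ + t₁) * (t₁ - S₁) * (s₁ ^ 2 + (t₁ - S₁) * s₁ + t₁ ^ 2 - t₁ * S₁ + S₁ ^ 2)) /
      (2 * h + 3 * (s₁ + t₁) * (t₁ - S₁)) ∧
    x 0 * x 2 + x 1 * x 3 = s₁ ∧ (x 0 * x 2) * (x 1 * x 3) = s₂ ∧
    -(y 0 * y 2) + -(y 1 * y 3) = t₁ ∧ (-(y 0 * y 2)) * (-(y 1 * y 3)) = t₂ ∧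
    -(x 0 * x 3) + -(x 1 * x 2) = S₁ ∧ (-(x 0 * x 3)) * (-(x 1 * x 2)) = s₂ ∧
    y 0 * y 3 + y 1 * y 2 = T₁ ∧ (y 0 * y 3) * (y 1 * y 2) = t₂

end Formulas

/-! ### The curves over `ℚ(m)` -/

/-- The field `ℚ(m)`. -/
abbrev Qm : Type := RatFunc ℚ

noncomputable instance : DecidableEq Qm := Classical.decEq _

/-- The indeterminate `m`. -/
noncomputable abbrev mm : Qm := RatFunc.X

/-- The cubic curve over `ℚ(m)`. -/
noncomputable abbrev E : WeierstrassCurve.Affine Qm := (cubic mm).toAffine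

/-- The coordinate ring `ℚ(m)[u, v] / (v² - φ(u))` of the quartic curve. -/
abbrev QuarticRing : Type := AdjoinRoot (X ^ 2 - C (phiPoly mm) : Qm[X][X])

/-- The function field of the quartic curve. -/
abbrev QuarticField : Type := FractionRing QuarticRing

/-- The coordinate functions on the quartic. -/
noncomputable def uFun : QuarticField :=
  algebraMap QuarticRing QuarticField (AdjoinRoot.of _ X)

noncomputable def vFun : QuarticField :=
  algebraMap QuarticRing QuarticField (AdjoinRoot.root _)

/-- The coordinate functions on the cubic. -/
noncomputable def UFun : E.FunctionField :=
  algebraMap E.CoordinateRing E.FunctionField (WeierstrassCurve.Affine.CoordinateRing.mk E (C X))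

noncomputable def VFun : E.FunctionField :=
  algebraMap E.CoordinateRing E.FunctionField (WeierstrassCurve.Affine.CoordinateRing.mk E X)

/-- The given formulas define mutually inverse birational maps between the two curves, that is,
an isomorphism over `ℚ(m)` of their function fields. -/
def BirationalByFormulas : Prop :=
  ∃ e : QuarticField ≃ₐ[Qm] E.FunctionField,
    let m : E.FunctionField := algebraMap Qm E.FunctionField mm
    psi m UFun VFun ≠ 0 ∧ e uFun = uOf m UFun VFun ∧ e vFun = vOf m UFun VFun ∧
    e uFun ≠ 0 ∧ UFun = UOf m (e uFun) (e vFun) ∧ VFun = VOf m (e uFun) (e vFun)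

/-! ### Integer polynomials as finite data -/

/-- The polynomial in `ℤ[m]` with the given list of coefficients, constant coefficient first. -/
noncomputable def toPoly (l : List ℤ) : ℤ[X] := l.foldr (fun a p => C a + X * p) 0

/-- The same polynomial as an element of `ℚ(m)`. -/
noncomputable def toQm (l : List ℤ) : Qm := aeval mm (toPoly l)

end FifthPowers

/-! Put X₁ = x₁x₃, X₂ = x₂x₄, Y₁ = -x₁x₄, Y₂ = -x₂x₃ and similarly X₃, X₄, Y₃, Y₄ from the y's. For
odd k the equation with exponent k becomes ΣXᵢᵏ = ΣYᵢᵏ, subject to X₁X₂ = Y₁Y₂ and X₃X₄ = Y₃Y₄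
(`powerEq_sol_iff`). Normalise S₁ = 1 and write k = (m²-1)/(3m²+1). The four pairs then have sums
h-k, 1-h, 1, -k and products p, p-h, p, p-h, where p = `prodS` makes the fifth powers agree
(`roots_pow_five`). Each pair is rational exactly when its discriminant is a square. The choice of k
does this for both X-pairs; the discriminant of (Y₁, Y₂) is a quadratic in h and a square at h = 0,
so lines through that point parametrise h by u; the last condition is v² = φ(u).

Since φ(0) is a square q², the quartic has a classical Tate model, which the cubic E becomes after a
linear change of coordinates (`cubic_to_quartic`). On function fields this gives a homomorphism that
is injective because u is transcendental and φ is not a square in K(u), and surjective because U and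
V are recovered from u and v.

Everything arithmetical is read off at one place, t = m²+3. There E has good reduction, and P' lies
in the kernel of reduction: t²U and t³V take the values 96² and -96³. Rescaled by t, the curve
reduces to the cusp y² = x³, whose smooth points form an additive group, so nP' has leading
coefficients 96²/n² and -96³/n³ (`exists_zsmul`). Hence nP' is never 0, ψ does not vanish at it, and
u/t has a value linear in n. Then h/t² has the value 3n(2n-1)/16, which is nonzero, so that the
equation with exponent 3 fails, and which distinguishes the solutions, since s₁/S₁ = h/S₁² - k is
unchanged by scaling (`ratioH_injective`, `ratioH_eq_of_scalingEquiv`).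

Computability holds because from 2P' on the multiples obey the chord recursion with fixed second
point P', which numerators and a common denominator in ℤ[m] follow by primitive recursion
(`RatPrimrec.of_chord_recursion`). -/

namespace FifthPowers

open Polynomial

/-! ### The birational transformation between a quartic with square constant term and a cubic -/

section Quartic

variable {L : Type*} [Field L]

/-- The cubic attached to a quartic `a u⁴ + b u³ + c u² + d u + q²`, after completing the square
and the cube, is satisfied by `(U, V)` only if the Tate form is satisfied by `(X, Y)`. -/
theorem tate_equation_of_cubic {a b c d q X Y : L} (hq : q ≠ 0) (h2 : (2 : L) ≠ 0)
    (h3 : (3 : L) ≠ 0)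
    (h : (27 * Y + 27 * d * X / (2 * q) + 27 * q * b) ^ 2 = (9 * X + 3 * c) ^ 3
      - 27 * (12 * a * q ^ 2 - 3 * b * d + c ^ 2) * (9 * X + 3 * c)
      - 27 * (72 * a * c * q ^ 2 + 9 * b * c * d - 27 * a * d ^ 2 - 27 * q ^ 2 * b ^ 2
        - 2 * c ^ 3)) :
    (4 * q ^ 2 * (X + c) - d ^ 2) * (X ^ 2 - 4 * q ^ 2 * a)
      = 2 * q * Y * (2 * q * Y + 2 * d * X + 4 * q ^ 2 * b) := by
  have h729 : (729 : L) ≠ 0 := by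
    have : (729 : L) = 3 ^ 6 := by norm_num
    rw [this]; exact pow_ne_zero _ h3
  field_simp at h
  apply mul_left_cancel₀ h729
  linear_combination -h

/-- The point of the quartic given by a point of the Tate form. -/
theorem quartic_of_tate {a b c d q X Y u v : L} (hq : q ≠ 0) (h2 : (2 : L) ≠ 0) (hY : Y ≠ 0)
    (h : (4 * q ^ 2 * (X + c) - d ^ 2) * (X ^ 2 - 4 * q ^ 2 * a)
      = 2 * q * Y * (2 * q * Y + 2 * d * X + 4 * q ^ 2 * b))
    (hu : 2 * q * Y * u = 4 * q ^ 2 * (X + c) - d ^ 2)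
    (hv : 2 * q * (v + q) = u * (u * X - d)) :
    v ^ 2 = a * u ^ 4 + b * u ^ 3 + c * u ^ 2 + d * u + q ^ 2 := by
  have h1 : u * (X ^ 2 - 4 * q ^ 2 * a) = 2 * q * Y + 2 * d * X + 4 * q ^ 2 * b := by
    apply mul_left_cancel₀ (mul_ne_zero (mul_ne_zero h2 hq) hY)
    linear_combination h + (X ^ 2 - 4 * q ^ 2 * a) * hu
  apply mul_left_cancel₀ (pow_ne_zero 2 (mul_ne_zero h2 hq))
  linear_combination (2 * q * (v + q) + u * (u * X - d) - 4 * q ^ 2) * hv + u ^ 3 * h1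
    + u ^ 2 * hu

end Quartic

variable {L : Type*} [Field L]

theorem phi_eq (m u : L) : phi m u
    = (m ^ 6 - 26 * m ^ 4 - 31 * m ^ 2 - 8) * (m + 1) ^ 2 * u ^ 4
      + -4 * m * (m + 1) * (m ^ 2 + 3) * (m ^ 4 - 6 * m ^ 2 - 3) * u ^ 3
      + 2 * (m - 1) * (m + 1) * (3 * m ^ 6 + 28 * m ^ 4 + 31 * m ^ 2 + 2) * u ^ 2
      + -4 * m * (m - 1) * (m ^ 2 + 3) * (m ^ 4 + 6 * m ^ 2 + 1) * u
      + (m * (m + 1) * (m - 1) ^ 2) ^ 2 := by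
  simp only [phi, phiCoeff, Fin.sum_univ_five]
  simp
  ring

theorem cubic_equation_iff (m U V : L) : (cubic m).toAffine.Equation U V ↔
    V ^ 2 = U ^ 3 + (cubic m).a₄ * U + (cubic m).a₆ := by
  rw [WeierstrassCurve.Affine.equation_iff]
  simp [cubic]

/-- The long formula for v is Tate's relation 2q(v + q) = u(uX - d) solved for v, with q =
m(m+1)(m-1)², X = (U - 3c)/9, and c, d the coefficients of u², u in φ. It is an identity in U and V,
valid off the curve too. -/
theorem vOf_spec {m U V : L} (hm : m ≠ 0) (hm1 : m - 1 ≠ 0) (h3 : (3 : L) ≠ 0)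
    (hpsi : psi m U V ≠ 0) :
    2 * (m * (m + 1) * (m - 1) ^ 2) * (vOf m U V + m * (m + 1) * (m - 1) ^ 2)
      = uOf m U V * (uOf m U V *
        ((U - 3 * (2 * (m - 1) * (m + 1) * (3 * m ^ 6 + 28 * m ^ 4 + 31 * m ^ 2 + 2))) / 9)
        - (-4 * m * (m - 1) * (m ^ 2 + 3) * (m ^ 4 + 6 * m ^ 2 + 1))) := by
  have h9 : (9 : L) ≠ 0 := by
    have : (9 : L) = 3 ^ 2 := by norm_num
    rw [this]; exact pow_ne_zero _ h3
  unfold vOf uOf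
  field_simp
  unfold psi
  ring

/-- Up to a factor, `psi` is the ordinate in the Tate form. -/
theorem psi_spec {m U V X Y : L} (hm : m ≠ 0) (hm1 : m - 1 ≠ 0) (hm2 : m + 1 ≠ 0)
    (h2 : (2 : L) ≠ 0)
    (hU : U = 9 * X + 3 * (2 * (m - 1) * (m + 1) * (3 * m ^ 6 + 28 * m ^ 4 + 31 * m ^ 2 + 2)))
    (hV : V = 27 * Y + 27 * (-4 * m * (m - 1) * (m ^ 2 + 3) * (m ^ 4 + 6 * m ^ 2 + 1)) * X
        / (2 * (m * (m + 1) * (m - 1) ^ 2))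
      + 27 * (m * (m + 1) * (m - 1) ^ 2)
        * (-4 * m * (m + 1) * (m ^ 2 + 3) * (m ^ 4 - 6 * m ^ 2 - 3))) :
    psi m U V = 27 * (m ^ 2 - 1) * Y := by
  rw [hU, hV]
  unfold psi
  field_simp
  ring

/-- The formula for u is 2qYu = 4q²(X + c) - d², the factor on the left of the Tate form; ψ stands
for Y in its denominator. -/
theorem uOf_spec {m U V X Y : L} (hm1 : m - 1 ≠ 0) (hm2 : m + 1 ≠ 0)
    (h3 : (3 : L) ≠ 0) (hY : Y ≠ 0)
    (hU : U = 9 * X + 3 * (2 * (m - 1) * (m + 1) * (3 * m ^ 6 + 28 * m ^ 4 + 31 * m ^ 2 + 2)))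
    (hpsi : psi m U V = 27 * (m ^ 2 - 1) * Y) :
    2 * (m * (m + 1) * (m - 1) ^ 2) * Y * uOf m U V = 4 * (m * (m + 1) * (m - 1) ^ 2) ^ 2
      * (X + 2 * (m - 1) * (m + 1) * (3 * m ^ 6 + 28 * m ^ 4 + 31 * m ^ 2 + 2))
      - (-4 * m * (m - 1) * (m ^ 2 + 3) * (m ^ 4 + 6 * m ^ 2 + 1)) ^ 2 := by
  have h27 : (27 : L) ≠ 0 := by
    have : (27 : L) = 3 ^ 3 := by norm_num
    rw [this]; exact pow_ne_zero _ h3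
  have e : (m ^ 2 - 1 : L) = (m - 1) * (m + 1) := by ring
  rw [uOf, hpsi, hU, e]
  field_simp
  ring

/-- The formulas map the cubic to the quartic, and the inverse formulas recover the point. -/
theorem cubic_to_quartic {m U V : L} (hm : m ≠ 0) (hm1 : m - 1 ≠ 0) (hm2 : m + 1 ≠ 0)
    (h2 : (2 : L) ≠ 0) (h3 : (3 : L) ≠ 0)
    (hE : V ^ 2 = U ^ 3 + (cubic m).a₄ * U + (cubic m).a₆) (hpsi : psi m U V ≠ 0) :
    vOf m U V ^ 2 = phi m (uOf m U V) ∧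
      (uOf m U V ≠ 0 → UOf m (uOf m U V) (vOf m U V) = U ∧
        VOf m (uOf m U V) (vOf m U V) = V) := by
  have h9 : (9 : L) ≠ 0 := by
    have : (9 : L) = 3 ^ 2 := by norm_num
    rw [this]; exact pow_ne_zero _ h3
  have h27 : (27 : L) ≠ 0 := by
    have : (27 : L) = 3 ^ 3 := by norm_num
    rw [this]; exact pow_ne_zero _ h3
  have hv := vOf_spec hm hm1 h3 hpsi
  have hq : m * (m + 1) * (m - 1) ^ 2 ≠ 0 :=
    mul_ne_zero (mul_ne_zero hm hm2) (pow_ne_zero _ hm1)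
  -- X and Y are the Tate coordinates: U = 9X + 3c and V = 27(Y + dX/(2q) + qb) undo the completion
  -- of the cube and the square.
  obtain ⟨X, hX⟩ : ∃ X, X = (U - 3 * (2 * (m - 1) * (m + 1)
    * (3 * m ^ 6 + 28 * m ^ 4 + 31 * m ^ 2 + 2))) / 9 := ⟨_, rfl⟩
  rw [← hX] at hv
  have hU : U = 9 * X + 3 * (2 * (m - 1) * (m + 1)
      * (3 * m ^ 6 + 28 * m ^ 4 + 31 * m ^ 2 + 2)) := by
    rw [hX]; field_simp; ring
  obtain ⟨Y, hY⟩ : ∃ Y, Y = (V - 27 * (-4 * m * (m - 1) * (m ^ 2 + 3) * (m ^ 4 + 6 * m ^ 2 + 1))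
        * X / (2 * (m * (m + 1) * (m - 1) ^ 2))
      - 27 * (m * (m + 1) * (m - 1) ^ 2)
        * (-4 * m * (m + 1) * (m ^ 2 + 3) * (m ^ 4 - 6 * m ^ 2 - 3))) / 27 := ⟨_, rfl⟩
  have hV : V = 27 * Y + 27 * (-4 * m * (m - 1) * (m ^ 2 + 3) * (m ^ 4 + 6 * m ^ 2 + 1)) * X
        / (2 * (m * (m + 1) * (m - 1) ^ 2))
      + 27 * (m * (m + 1) * (m - 1) ^ 2)
        * (-4 * m * (m + 1) * (m ^ 2 + 3) * (m ^ 4 - 6 * m ^ 2 - 3)) := by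
    have : 27 * Y = V - 27 * (-4 * m * (m - 1) * (m ^ 2 + 3) * (m ^ 4 + 6 * m ^ 2 + 1))
        * X / (2 * (m * (m + 1) * (m - 1) ^ 2))
      - 27 * (m * (m + 1) * (m - 1) ^ 2)
        * (-4 * m * (m + 1) * (m ^ 2 + 3) * (m ^ 4 - 6 * m ^ 2 - 3)) := by
      rw [hY, mul_div_cancel₀ _ h27]
    rw [this]; ring
  have hps := psi_spec hm hm1 hm2 h2 hU hV
  have hY0 : Y ≠ 0 := by
    rintro rfl
    exact hpsi (by rw [hps, mul_zero])
  have hu := uOf_spec hm1 hm2 h3 hY0 hU hps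
  have hT := tate_equation_of_cubic (a := (m ^ 6 - 26 * m ^ 4 - 31 * m ^ 2 - 8) * (m + 1) ^ 2)
    (b := -4 * m * (m + 1) * (m ^ 2 + 3) * (m ^ 4 - 6 * m ^ 2 - 3))
    (c := 2 * (m - 1) * (m + 1) * (3 * m ^ 6 + 28 * m ^ 4 + 31 * m ^ 2 + 2))
    (d := -4 * m * (m - 1) * (m ^ 2 + 3) * (m ^ 4 + 6 * m ^ 2 + 1)) (X := X) (Y := Y) hq h2 h3
    (by
      rw [← hV, ← hU, hE]
      simp only [cubic]
      ring)
  refine ⟨(quartic_of_tate hq h2 hY0 hT hu hv).trans (phi_eq _ _).symm, fun hu0 => ?_⟩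
  generalize uOf m U V = u at *
  generalize vOf m U V = v at *
  constructor
  · rw [UOf, div_eq_iff (pow_ne_zero _ hu0), hU]
    linear_combination 9 * hv
  · rw [VOf, div_eq_iff (pow_ne_zero _ hu0)]
    have hV' : 2 * (m * (m + 1) * (m - 1) ^ 2) * V
        = 54 * (m * (m + 1) * (m - 1) ^ 2) * Y
        + 27 * (-4 * m * (m - 1) * (m ^ 2 + 3) * (m ^ 4 + 6 * m ^ 2 + 1)) * X
        + 54 * (m * (m + 1) * (m - 1) ^ 2) ^ 2
          * (-4 * m * (m + 1) * (m ^ 2 + 3) * (m ^ 4 - 6 * m ^ 2 - 3)) := by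
      rw [hV]; field_simp; ring
    apply mul_left_cancel₀ (mul_ne_zero h2 hq)
    linear_combination (27 * u * (-4 * m * (m - 1) * (m ^ 2 + 3) * (m ^ 4 + 6 * m ^ 2 + 1))
      + 108 * (m * (m + 1) * (m - 1) ^ 2) ^ 2) * hv - u ^ 3 * hV' - 27 * u ^ 2 * hu

/-! ### The place `m² = -3` of `ℚ(m)` -/

/-- A square root of `-3`. -/
noncomputable def rootNegThree : ℂ := Complex.I * (Real.sqrt 3 : ℝ)

local notation "ρ" => rootNegThree

theorem rootNegThree_sq : ρ ^ 2 = -3 := by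
  rw [rootNegThree, mul_pow, Complex.I_sq, ← Complex.ofReal_pow, Real.sq_sqrt (by norm_num)]
  norm_num

theorem rootNegThree_ne_zero : ρ ≠ 0 := fun h => by
  have := rootNegThree_sq
  rw [h] at this
  norm_num at this

theorem rootNegThree_sub_one_ne_zero : ρ - 1 ≠ 0 := fun h => by
  have := rootNegThree_sq
  rw [sub_eq_zero.mp h] at this
  norm_num at this

theorem rootNegThree_add_one_ne_zero : ρ + 1 ≠ 0 := fun h => by
  have := rootNegThree_sq
  rw [eq_neg_of_add_eq_zero_left h] at this
  norm_num at this

/-- The rational function `x` is regular at `√-3`, with the value `a` there. -/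
def HasVal (x : Qm) (a : ℂ) : Prop :=
  ∃ p q : ℚ[X], aeval ρ q ≠ 0 ∧ x = algebraMap ℚ[X] Qm p / algebraMap ℚ[X] Qm q ∧
    a = aeval ρ p / aeval ρ q

namespace HasVal

theorem map_ne_zero {q : ℚ[X]} (h : aeval ρ q ≠ 0) : algebraMap ℚ[X] Qm q ≠ 0 := by
  intro h0
  rw [FaithfulSMul.algebraMap_eq_zero_iff] at h0
  rw [h0, map_zero] at h
  exact h rfl

theorem of_poly (p : ℚ[X]) : HasVal (algebraMap ℚ[X] Qm p) (aeval ρ p) :=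
  ⟨p, 1, by simp, by simp, by simp⟩

theorem X : HasVal mm ρ := by
  simpa using of_poly Polynomial.X

theorem natCast (n : ℕ) : HasVal (n : Qm) n := by
  simpa using of_poly (n : ℚ[X])

theorem ofNat (n : ℕ) [n.AtLeastTwo] : HasVal (OfNat.ofNat n : Qm) (OfNat.ofNat n) := by
  simpa only [Nat.cast_ofNat] using natCast (OfNat.ofNat n)

theorem one : HasVal 1 1 := by
  simpa using natCast 1

variable {x y : Qm} {a b : ℂ}

theorem add (hx : HasVal x a) (hy : HasVal y b) : HasVal (x + y) (a + b) := by
  obtain ⟨p, q, hq, rfl, rfl⟩ := hx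
  obtain ⟨p', q', hq', rfl, rfl⟩ := hy
  refine ⟨p * q' + q * p', q * q', by simp [hq, hq'], ?_, ?_⟩
  · rw [div_add_div _ _ (map_ne_zero hq) (map_ne_zero hq')]
    simp
  · rw [div_add_div _ _ hq hq']
    simp

theorem mul (hx : HasVal x a) (hy : HasVal y b) : HasVal (x * y) (a * b) := by
  obtain ⟨p, q, hq, rfl, rfl⟩ := hx
  obtain ⟨p', q', hq', rfl, rfl⟩ := hy
  refine ⟨p * p', q * q', by simp [hq, hq'], ?_, ?_⟩
  · rw [div_mul_div_comm]
    simp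
  · rw [div_mul_div_comm]
    simp

theorem neg (hx : HasVal x a) : HasVal (-x) (-a) := by
  obtain ⟨p, q, hq, rfl, rfl⟩ := hx
  exact ⟨-p, q, hq, by simp [neg_div], by simp [neg_div]⟩

theorem sub (hx : HasVal x a) (hy : HasVal y b) : HasVal (x - y) (a - b) := by
  rw [sub_eq_add_neg, sub_eq_add_neg]
  exact hx.add hy.neg

theorem pow (hx : HasVal x a) (n : ℕ) : HasVal (x ^ n) (a ^ n) := by
  induction n with
  | zero => simpa using one
  | succ n ih => rw [pow_succ, pow_succ]; exact ih.mul hx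

theorem inv (hx : HasVal x a) (ha : a ≠ 0) : HasVal x⁻¹ a⁻¹ := by
  obtain ⟨p, q, hq, rfl, rfl⟩ := hx
  exact ⟨q, p, (div_ne_zero_iff.mp ha).1, by rw [inv_div], by rw [inv_div]⟩

theorem div (hx : HasVal x a) (hy : HasVal y b) (hb : b ≠ 0) : HasVal (x / y) (a / b) := by
  rw [div_eq_mul_inv, div_eq_mul_inv]
  exact hx.mul (hy.inv hb)

theorem eq_zero (h : HasVal 0 a) : a = 0 := by
  obtain ⟨p, q, hq, h0, rfl⟩ := h
  rcases div_eq_zero_iff.mp h0.symm with h1 | h1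
  · rw [FaithfulSMul.algebraMap_eq_zero_iff] at h1
    rw [h1, map_zero, zero_div]
  · exact absurd h1 (map_ne_zero hq)

theorem ne_zero (h : HasVal x a) (ha : a ≠ 0) : x ≠ 0 := by
  rintro rfl
  exact ha h.eq_zero

theorem unique (hx : HasVal x a) (hy : HasVal x b) : a = b := by
  have := hx.sub hy
  rw [sub_self] at this
  exact sub_eq_zero.mp this.eq_zero

theorem congr (hx : HasVal x a) (hxy : x = y) (hab : a = b) : HasVal y b := hxy ▸ hab ▸ hx

end HasVal

theorem mm_ne_zero : mm ≠ 0 := HasVal.X.ne_zero rootNegThree_ne_zero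

theorem mm_sub_one_ne_zero : mm - 1 ≠ 0 :=
  (HasVal.X.sub HasVal.one).ne_zero rootNegThree_sub_one_ne_zero

theorem mm_add_one_ne_zero : mm + 1 ≠ 0 :=
  (HasVal.X.add HasVal.one).ne_zero rootNegThree_add_one_ne_zero

theorem mm_sq_add_three_ne_zero : mm ^ 2 + 3 ≠ 0 := by
  intro h
  have h1 : algebraMap ℚ[X] Qm (Polynomial.X ^ 2 + 3) = 0 := by simpa [map_ofNat] using h
  rw [FaithfulSMul.algebraMap_eq_zero_iff] at h1
  have := congrArg (eval 0) h1
  norm_num at this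

theorem rootNegThree_pow_even (n : ℕ) : ρ ^ (2 * n) = (-3) ^ n := by
  rw [pow_mul, rootNegThree_sq]

theorem rootNegThree_sub_mul_add : (ρ - 1) * (ρ + 1) = -4 := by
  linear_combination rootNegThree_sq

theorem hasVal_a₄ : HasVal (cubic mm).a₄ (-54853632) := by
  refine HasVal.congr (a := (cubic ρ).a₄) ?_ rfl ?_
  · simp only [cubic]
    repeat first
      | exact HasVal.X | exact HasVal.one | exact HasVal.ofNat _ | apply HasVal.add
      | apply HasVal.sub | apply HasVal.mul | apply HasVal.pow | apply HasVal.neg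
  · simp only [cubic]
    rw [mul_assoc (-432), rootNegThree_sub_mul_add, rootNegThree_pow_even 1,
      rootNegThree_pow_even 2, rootNegThree_pow_even 3, rootNegThree_pow_even 4,
      rootNegThree_pow_even 5]
    norm_num

theorem hasVal_a₆ : HasVal (cubic mm).a₆ 154014842880 := by
  refine HasVal.congr (a := (cubic ρ).a₆) ?_ rfl ?_
  · simp only [cubic]
    repeat first
      | exact HasVal.X | exact HasVal.one | exact HasVal.ofNat _ | apply HasVal.add
      | apply HasVal.sub | apply HasVal.mul | apply HasVal.pow | apply HasVal.neg
  · simp only [cubic]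
    rw [mul_assoc, ← mul_pow, rootNegThree_sub_mul_add, rootNegThree_pow_even 1,
      rootNegThree_pow_even 2, rootNegThree_pow_even 3, rootNegThree_pow_even 4,
      rootNegThree_pow_even 5]
    norm_num

/-- The discriminant has a nonzero value already at m² = -3, so E has good reduction at this place.
-/
theorem cubic_Δ_ne_zero : (cubic mm).Δ ≠ 0 := by
  have h : (cubic mm).Δ = -64 * (cubic mm).a₄ ^ 3 - 432 * (cubic mm).a₆ ^ 2 := by
    simp only [WeierstrassCurve.Δ, WeierstrassCurve.b₂, WeierstrassCurve.b₄, WeierstrassCurve.b₆,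
      WeierstrassCurve.b₈, show (cubic mm).a₁ = 0 from rfl, show (cubic mm).a₂ = 0 from rfl,
      show (cubic mm).a₃ = 0 from rfl]
    ring
  rw [h]
  refine (((HasVal.ofNat 64).neg.mul (hasVal_a₄.pow 3)).sub
    ((HasVal.ofNat 432).mul (hasVal_a₆.pow 2))).ne_zero ?_
  norm_num

theorem cubic_isElliptic : (cubic mm).IsElliptic := ⟨cubic_Δ_ne_zero.isUnit⟩

/-! ### The point P' and its poles at m² = -3 -/

/-- The numerator of `U₀`. -/
def numU₀ {L : Type*} [Field L] (m : L) : L :=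
  12 * (75 * m ^ 28 + 1010 * m ^ 26 + 11944 * m ^ 24 + 103096 * m ^ 22 + 585657 * m ^ 20
    + 2202226 * m ^ 18 + 5635746 * m ^ 16 + 10027936 * m ^ 14 + 12482909 * m ^ 12
    + 10709526 * m ^ 10 + 6063588 * m ^ 8 + 2067944 * m ^ 6 + 398591 * m ^ 4
    + 39750 * m ^ 2 + 1650)

/-- The numerator of `V₀`. -/
def numV₀ {L : Type*} [Field L] (m : L) : L :=
  -(216 * (125 * m ^ 42 + 2525 * m ^ 40 + 12350 * m ^ 38 - 138015 * m ^ 36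
    - 2822345 * m ^ 34 - 24701264 * m ^ 32 - 140086792 * m ^ 30 - 573149148 * m ^ 28
    - 1776227438 * m ^ 26 - 4275792154 * m ^ 24 - 8087224924 * m ^ 22
    - 12040781858 * m ^ 20 - 14031203010 * m ^ 18 - 12641030116 * m ^ 16
    - 8645319848 * m ^ 14 - 4384538092 * m ^ 12 - 1605427583 * m ^ 10
    - 411694779 * m ^ 8 - 71091250 * m ^ 6 - 7771895 * m ^ 4 - 478725 * m ^ 2
    - 12500))

/-- The cofactor of `m² + 3` in the denominator of the point. -/
def cofDen {L : Type*} [Field L] (m : L) : L :=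
  (m - 1) * (m + 1) * (7 * m ^ 6 + 23 * m ^ 4 + 29 * m ^ 2 + 5)

theorem den_eq {L : Type*} [Field L] (m : L) : den m = (m ^ 2 + 3) * cofDen m := by
  rw [den, cofDen]; ring

theorem hasVal_cofDen : HasVal (cofDen mm) 256 := by
  refine HasVal.congr (a := cofDen ρ) ?_ rfl ?_
  · unfold cofDen
    repeat first
      | exact HasVal.X | exact HasVal.one | exact HasVal.ofNat _ | apply HasVal.add
      | apply HasVal.sub | apply HasVal.mul | apply HasVal.pow | apply HasVal.neg
  · rw [cofDen, rootNegThree_sub_mul_add, rootNegThree_pow_even 1, rootNegThree_pow_even 2,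
      rootNegThree_pow_even 3]
    norm_num

theorem den_ne_zero : den mm ≠ 0 := by
  rw [den_eq]
  exact mul_ne_zero mm_sq_add_three_ne_zero (hasVal_cofDen.ne_zero (by norm_num))

theorem hasVal_numU₀ : HasVal (numU₀ mm) 603979776 := by
  refine HasVal.congr (a := numU₀ ρ) ?_ rfl ?_
  · unfold numU₀
    repeat first
      | exact HasVal.X | exact HasVal.one | exact HasVal.ofNat _ | apply HasVal.add
      | apply HasVal.sub | apply HasVal.mul | apply HasVal.pow | apply HasVal.neg
  · rw [numU₀,
      rootNegThree_pow_even 1, rootNegThree_pow_even 2, rootNegThree_pow_even 3,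
      rootNegThree_pow_even 4, rootNegThree_pow_even 5, rootNegThree_pow_even 6,
      rootNegThree_pow_even 7, rootNegThree_pow_even 8, rootNegThree_pow_even 9,
      rootNegThree_pow_even 10, rootNegThree_pow_even 11, rootNegThree_pow_even 12,
      rootNegThree_pow_even 13, rootNegThree_pow_even 14]
    norm_num

theorem hasVal_numV₀ : HasVal (numV₀ mm) (-14843406974976) := by
  refine HasVal.congr (a := numV₀ ρ) ?_ rfl ?_
  · unfold numV₀
    repeat first
      | exact HasVal.X | exact HasVal.one | exact HasVal.ofNat _ | apply HasVal.add
      | apply HasVal.sub | apply HasVal.mul | apply HasVal.pow | apply HasVal.neg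
  · rw [numV₀,
      rootNegThree_pow_even 1, rootNegThree_pow_even 2, rootNegThree_pow_even 3,
      rootNegThree_pow_even 4, rootNegThree_pow_even 5, rootNegThree_pow_even 6,
      rootNegThree_pow_even 7, rootNegThree_pow_even 8, rootNegThree_pow_even 9,
      rootNegThree_pow_even 10, rootNegThree_pow_even 11, rootNegThree_pow_even 12,
      rootNegThree_pow_even 13, rootNegThree_pow_even 14, rootNegThree_pow_even 15,
      rootNegThree_pow_even 16, rootNegThree_pow_even 17, rootNegThree_pow_even 18,
      rootNegThree_pow_even 19, rootNegThree_pow_even 20, rootNegThree_pow_even 21]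
    norm_num

/-- The value is 96², and -96³ for the ordinate below: after rescaling by the uniformizer, P'
reduces to the smooth point (96², -96³) of the cusp y² = x³. -/
theorem hasVal_U₀ : HasVal ((mm ^ 2 + 3) ^ 2 * U₀ mm) 9216 := by
  have h3 := mm_sq_add_three_ne_zero
  refine (hasVal_numU₀.div (hasVal_cofDen.pow 2) (by norm_num)).congr ?_ (by norm_num)
  rw [show U₀ mm = numU₀ mm / den mm ^ 2 from rfl, den_eq]
  field_simp

theorem hasVal_V₀ : HasVal ((mm ^ 2 + 3) ^ 3 * V₀ mm) (-884736) := by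
  have h3 := mm_sq_add_three_ne_zero
  refine (hasVal_numV₀.div (hasVal_cofDen.pow 3) (by norm_num)).congr ?_ (by norm_num)
  rw [show V₀ mm = numV₀ mm / den mm ^ 3 from rfl, den_eq]
  field_simp

theorem numV₀_sq {L : Type*} [Field L] (m : L) : numV₀ m ^ 2
    = numU₀ m ^ 3 + (cubic m).a₄ * numU₀ m * den m ^ 4 + (cubic m).a₆ * den m ^ 6 := by
  simp only [numU₀, numV₀, den, cubic]
  ring

theorem equation_point : V₀ mm ^ 2 = U₀ mm ^ 3 + (cubic mm).a₄ * U₀ mm + (cubic mm).a₆ := by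
  have h := numV₀_sq mm
  have hd := den_ne_zero
  rw [show U₀ mm = numU₀ mm / den mm ^ 2 from rfl, show V₀ mm = numV₀ mm / den mm ^ 3 from rfl]
  field_simp
  linear_combination h

/-! ### The multiples of the point at the place `m² = -3` -/

theorem E_add_of_X_ne {x₁ y₁ x₂ y₂ : Qm} {h₁ : E.Nonsingular x₁ y₁} {h₂ : E.Nonsingular x₂ y₂}
    (hx : x₁ ≠ x₂) : ∃ (x y : Qm) (h : E.Nonsingular x y),
      (WeierstrassCurve.Affine.Point.some x₁ y₁ h₁ : E.Point) + .some x₂ y₂ h₂ = .some x y h ∧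
      x = ((y₁ - y₂) / (x₁ - x₂)) ^ 2 - x₁ - x₂ ∧
      y = (y₁ - y₂) / (x₁ - x₂) * (x₁ - x) - y₁ := by
  refine ⟨_, _, _, WeierstrassCurve.Affine.Point.add_of_X_ne hx, ?_, ?_⟩
  · rw [WeierstrassCurve.Affine.slope_of_X_ne hx, WeierstrassCurve.Affine.addX]
    simp [cubic]
  · rw [WeierstrassCurve.Affine.slope_of_X_ne hx, WeierstrassCurve.Affine.addY,
      WeierstrassCurve.Affine.negAddY, WeierstrassCurve.Affine.negY, WeierstrassCurve.Affine.addX]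
    simp [cubic]
    ring

theorem E_add_self {x₁ y₁ : Qm} {h₁ : E.Nonsingular x₁ y₁} (hy : y₁ ≠ 0) :
    ∃ (x y : Qm) (h : E.Nonsingular x y),
      (WeierstrassCurve.Affine.Point.some x₁ y₁ h₁ : E.Point) + .some x₁ y₁ h₁ = .some x y h ∧
      x = ((3 * x₁ ^ 2 + (cubic mm).a₄) / (2 * y₁)) ^ 2 - x₁ - x₁ ∧
      y = (3 * x₁ ^ 2 + (cubic mm).a₄) / (2 * y₁) * (x₁ - x) - y₁ := by
  have hn : E.negY x₁ y₁ = -y₁ := by simp [WeierstrassCurve.Affine.negY, cubic]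
  have hy' : y₁ ≠ E.negY x₁ y₁ := by
    rw [hn]
    exact fun h => hy (self_eq_neg.mp h)
  have hs : E.slope x₁ x₁ y₁ y₁ = (3 * x₁ ^ 2 + (cubic mm).a₄) / (2 * y₁) := by
    rw [WeierstrassCurve.Affine.slope_of_Y_ne rfl hy', hn]
    simp [cubic]
    ring
  refine ⟨_, _, _, WeierstrassCurve.Affine.Point.add_self_of_Y_ne hy', ?_, ?_⟩
  · rw [hs, WeierstrassCurve.Affine.addX]
    simp [cubic]
  · rw [hs, WeierstrassCurve.Affine.addY,
      WeierstrassCurve.Affine.negAddY, WeierstrassCurve.Affine.negY, WeierstrassCurve.Affine.addX]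
    simp [cubic]
    ring

theorem hasVal_uniformizer : HasVal (mm ^ 2 + 3) 0 :=
  ((HasVal.X.pow 2).add (HasVal.ofNat 3)).congr rfl (by rw [rootNegThree_sq]; norm_num)

/-- The leading coefficients of the coordinates of `nP'` at the place `m² = -3`. -/
def LeadsLike (n : ℂ) (U V : Qm) : Prop :=
  HasVal ((mm ^ 2 + 3) ^ 2 * U) (9216 / n ^ 2) ∧ HasVal ((mm ^ 2 + 3) ^ 3 * V) (-884736 / n ^ 3)

theorem leadsLike_one : LeadsLike 1 (U₀ mm) (V₀ mm) :=
  ⟨hasVal_U₀.congr rfl (by norm_num), hasVal_V₀.congr rfl (by norm_num)⟩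

/-- The group law on the cuspidal cubic `V² = U³`. -/
theorem LeadsLike.add_one {n : ℂ} {U V s x y : Qm} (hn0 : n ≠ 0) (hn2 : n + 1 ≠ 0)
    (h : LeadsLike n U V)
    (hs : HasVal ((mm ^ 2 + 3) * s) (-96 * (n ^ 2 + n + 1) / (n * (n + 1))))
    (hx : x = s ^ 2 - U - U₀ mm) (hy : y = s * (U - x) - V) : LeadsLike (n + 1) x y := by
  have h1 : HasVal ((mm ^ 2 + 3) ^ 2 * x) (9216 / (n + 1) ^ 2) := by
    refine (((hs.pow 2).sub h.1).sub leadsLike_one.1).congr ?_ ?_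
    · rw [hx]; ring
    · field_simp; ring
  refine ⟨h1, ((hs.mul (h.1.sub h1)).sub h.2).congr ?_ ?_⟩
  · rw [hy]; ring
  · field_simp; ring

/-- On y² = x³ the chord through (96²/n², -96³/n³) and the point with n = 1 has slope
-96(1-n³)n²/(n³(1-n²)), and the factor 1-n cancels. For n ≠ ±1 the two abscissas differ already at
the place. -/
theorem LeadsLike.slope {n : ℂ} {U V : Qm} (hn0 : n ≠ 0) (hn1 : n - 1 ≠ 0) (hn2 : n + 1 ≠ 0)
    (h : LeadsLike n U V) : U ≠ U₀ mm ∧ HasVal ((mm ^ 2 + 3) * ((V - V₀ mm) / (U - U₀ mm)))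
      (-96 * (n ^ 2 + n + 1) / (n * (n + 1))) := by
  have hne : 9216 / n ^ 2 - 9216 / 1 ^ 2 ≠ 0 := by
    have : 9216 / n ^ 2 - 9216 / 1 ^ 2 = -9216 * (n - 1) * (n + 1) / n ^ 2 := by
      field_simp; ring
    rw [this]
    exact div_ne_zero (mul_ne_zero (mul_ne_zero (by norm_num) hn1) hn2) (pow_ne_zero _ hn0)
  have hd := h.1.sub leadsLike_one.1
  have hU : U - U₀ mm ≠ 0 := by
    intro h0
    rw [← mul_sub, h0, mul_zero] at hd
    exact hne hd.eq_zero
  refine ⟨sub_ne_zero.mp hU, ((h.2.sub leadsLike_one.2).div hd hne).congr ?_ ?_⟩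
  · have h3 := mm_sq_add_three_ne_zero
    rw [← mul_sub, ← mul_sub]
    field_simp
  · have e : 9216 / n ^ 2 - 9216 / 1 ^ 2 = -9216 * (n - 1) * (n + 1) / n ^ 2 := by
      field_simp; ring
    rw [e]
    field_simp
    ring

theorem V₀_ne_zero : V₀ mm ≠ 0 := by
  intro h
  have := hasVal_V₀
  rw [h, mul_zero] at this
  exact absurd this.eq_zero (by norm_num)

/-- The reduced chord slope extends to n = 1 as the tangent slope 3x²/(2y) of the cusp: a₄ is
regular and enters multiplied by the fourth power of the uniformizer. -/
theorem hasVal_tangent_slope :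
    HasVal ((mm ^ 2 + 3) * ((3 * U₀ mm ^ 2 + (cubic mm).a₄) / (2 * V₀ mm)))
      (-96 * ((1 : ℂ) ^ 2 + 1 + 1) / (1 * (1 + 1))) := by
  refine ((((HasVal.ofNat 3).mul (hasVal_U₀.pow 2)).add
    ((hasVal_uniformizer.pow 4).mul hasVal_a₄)).div
    ((HasVal.ofNat 2).mul hasVal_V₀) (by norm_num)).congr ?_ (by norm_num)
  have h3 := mm_sq_add_three_ne_zero
  have hV := V₀_ne_zero
  field_simp

variable (hP : E.Nonsingular (U₀ mm) (V₀ mm))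

/-- Induction on the multiple, adding P' each time. The leading coefficients show that nP' and P'
have different abscissas for n > 1, so the chord formula applies and the sum is affine. -/
theorem exists_nsmul (n : ℕ) : ∃ (U V : Qm) (h : E.Nonsingular U V),
    (n + 1) • (WeierstrassCurve.Affine.Point.some (U₀ mm) (V₀ mm) hP : E.Point) = .some U V h ∧
      LeadsLike (n + 1) U V := by
  induction n with
  | zero => exact ⟨_, _, hP, by simp, by simpa using leadsLike_one⟩
  | succ n ih =>
    obtain ⟨U, V, h, hn, hl⟩ := ih
    rw [succ_nsmul, hn]
    have hn2 : (n : ℂ) + 1 + 1 ≠ 0 := by exact_mod_cast Nat.succ_ne_zero (n + 1)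
    have hn1 : (n : ℂ) + 1 ≠ 0 := by exact_mod_cast Nat.succ_ne_zero n
    -- The step from P' to 2P' is a doubling and needs the tangent instead of the chord.
    rcases Nat.eq_zero_or_pos n with rfl | hpos
    · rw [zero_add, one_nsmul] at hn
      obtain ⟨rfl, rfl⟩ := WeierstrassCurve.Affine.Point.some.inj hn
      obtain ⟨x, y, hxy, e, hx, hy⟩ := E_add_self (h₁ := hP) V₀_ne_zero
      refine ⟨x, y, hxy, e, ?_⟩
      simpa using LeadsLike.add_one one_ne_zero (by norm_num) leadsLike_one hasVal_tangent_slope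
        hx hy
    · obtain ⟨hne, hs⟩ := hl.slope hn1 (by simpa using hpos.ne') hn2
      obtain ⟨x, y, hxy, e, hx, hy⟩ := E_add_of_X_ne (h₁ := h) (h₂ := hP) hne
      refine ⟨x, y, hxy, e, ?_⟩
      simpa using LeadsLike.add_one hn1 hn2 hl hs hx hy

theorem exists_zsmul {n : ℤ} (hn : n ≠ 0) : ∃ (U V : Qm) (h : E.Nonsingular U V),
    n • (WeierstrassCurve.Affine.Point.some (U₀ mm) (V₀ mm) hP : E.Point) = .some U V h ∧
      LeadsLike n U V := by
  rcases lt_or_gt_of_ne hn with h | h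
  · obtain ⟨k, rfl⟩ := Int.eq_negSucc_of_lt_zero h
    obtain ⟨U, V, h, e, hl⟩ := exists_nsmul hP k
    refine ⟨U, _, _, by rw [negSucc_zsmul, e, WeierstrassCurve.Affine.Point.neg_some], ?_⟩
    have hn : E.negY U V = -V := by simp [WeierstrassCurve.Affine.negY, cubic]
    refine ⟨hl.1.congr rfl ?_, hl.2.neg.congr (by rw [hn]; ring) ?_⟩
    · rw [Int.cast_negSucc]; push_cast; ring
    · rw [Int.cast_negSucc]; push_cast
      rw [Odd.neg_pow (by decide), div_neg, neg_div]
  · obtain ⟨k, rfl⟩ := Int.eq_succ_of_zero_lt h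
    obtain ⟨U, V, h, e, hl⟩ := exists_nsmul hP k
    refine ⟨U, V, h, by rw [← e]; exact natCast_zsmul _ _, by simpa using hl⟩

/-- The place `m² = -3` separates the values of `u` at the multiples of the point. -/
theorem LeadsLike.psi_ne_zero {n : ℂ} {U V : Qm} (hn : n ≠ 0) (h : LeadsLike n U V) :
    psi mm U V ≠ 0 ∧ HasVal (uOf mm U V / (mm ^ 2 + 3)) (ρ * (ρ - 1) * n / 4) := by
  have h3 := mm_sq_add_three_ne_zero
  have hm := (HasVal.X.pow 2).sub HasVal.one
  have hpsi : HasVal ((mm ^ 2 + 3) ^ 3 * psi mm U V) (3538944 / n ^ 3) := by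
    -- Only regularity of these coefficients matters: their terms have lower pole order than the
    -- V-term and vanish after multiplication by t³.
    have h1 : ∃ c, HasVal (6 * (mm ^ 2 + 3) * (mm ^ 4 + 6 * mm ^ 2 + 1)) c := by
      constructor
      repeat first
        | exact HasVal.X | exact HasVal.one | exact HasVal.ofNat _ | apply HasVal.add
        | apply HasVal.sub | apply HasVal.mul | apply HasVal.pow | apply HasVal.neg
    have h2 : ∃ c, HasVal (72 * (mm ^ 2 - 1) * (mm ^ 2 + 3)
        * (35 * mm ^ 8 + 86 * mm ^ 6 + 108 * mm ^ 4 + 26 * mm ^ 2 + 1)) c := by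
      constructor
      repeat first
        | exact HasVal.X | exact HasVal.one | exact HasVal.ofNat _ | apply HasVal.add
        | apply HasVal.sub | apply HasVal.mul | apply HasVal.pow | apply HasVal.neg
    obtain ⟨c₁, h1⟩ := h1
    obtain ⟨c₂, h2⟩ := h2
    refine (((hasVal_uniformizer.mul (h1.mul h.1)).add (hm.mul h.2)).sub
      ((hasVal_uniformizer.pow 3).mul h2)).congr ?_ ?_
    · rw [psi]; ring
    · rw [rootNegThree_sq]; ring
  have hpsi0 : psi mm U V ≠ 0 := by
    intro h0
    rw [h0, mul_zero] at hpsi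
    exact absurd hpsi.eq_zero (div_ne_zero (by norm_num) (pow_ne_zero _ hn))
  have hnum : HasVal ((mm ^ 2 + 3) ^ 2 * (6 * mm * (mm - 1) * ((mm + 1) ^ 2 * (mm - 1) ^ 2 * U
      - 420 * mm ^ 10 - 4812 * mm ^ 8
      - 12648 * mm ^ 6 - 14232 * mm ^ 4 - 4404 * mm ^ 2 - 348)))
      (ρ * (ρ - 1) * (884736 / n ^ 2)) := by
    have h1 : ∃ c, HasVal (420 * mm ^ 10 + 4812 * mm ^ 8
      + 12648 * mm ^ 6 + 14232 * mm ^ 4 + 4404 * mm ^ 2 + 348) c := by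
      constructor
      repeat first
        | exact HasVal.X | exact HasVal.one | exact HasVal.ofNat _ | apply HasVal.add
        | apply HasVal.sub | apply HasVal.mul | apply HasVal.pow | apply HasVal.neg
    obtain ⟨c₁, h1⟩ := h1
    refine ((((HasVal.ofNat 6).mul HasVal.X).mul (HasVal.X.sub HasVal.one)).mul
      (((hm.pow 2).mul h.1).sub ((hasVal_uniformizer.pow 2).mul h1))).congr ?_ ?_
    · ring
    · rw [rootNegThree_sq]; ring
  refine ⟨hpsi0, (hnum.div hpsi (div_ne_zero (by norm_num) (pow_ne_zero _ hn))).congr ?_ ?_⟩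
  · rw [uOf]
    field_simp
  · field_simp
    ring

/-! ### Computable arithmetic of integers and of lists of coefficients -/

theorem encode_ofNat (n : ℕ) : Encodable.encode (Int.ofNat n) = 2 * n := rfl

theorem encode_negSucc (n : ℕ) : Encodable.encode (Int.negSucc n) = 2 * n + 1 := rfl

/-- The encoding sends n to 2n and -(n+1) to 2n+1, so sign and absolute value are read from the code
by parity and halving. -/
theorem primrec_toNat : Primrec Int.toNat := by
  have h : Primrec fun z : ℤ => if Encodable.encode z % 2 = 0 then Encodable.encode z / 2 else 0 :=
    Primrec.ite (Primrec.eq.comp (Primrec.nat_mod.comp Primrec.encode (Primrec.const 2))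
      (Primrec.const 0)) (Primrec.nat_div.comp Primrec.encode (Primrec.const 2)) (Primrec.const 0)
  refine h.of_eq fun z => ?_
  cases z with
  | ofNat n => rw [encode_ofNat]; simp
  | negSucc n => rw [encode_negSucc, if_neg (by omega)]; rfl

theorem primrec_neg_toNat : Primrec fun z : ℤ => (-z).toNat := by
  have h : Primrec fun z : ℤ =>
      if Encodable.encode z % 2 = 0 then 0 else Encodable.encode z / 2 + 1 :=
    Primrec.ite (Primrec.eq.comp (Primrec.nat_mod.comp Primrec.encode (Primrec.const 2))
      (Primrec.const 0)) (Primrec.const 0)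
      (Primrec.succ.comp (Primrec.nat_div.comp Primrec.encode (Primrec.const 2)))
  refine h.of_eq fun z => ?_
  cases z with
  | ofNat n => rw [encode_ofNat]; simp
  | negSucc n => rw [encode_negSucc, if_neg (by omega), Int.neg_negSucc, Int.toNat_natCast]; omega

theorem primrec_natCast_sub : Primrec₂ fun a b : ℕ => (a : ℤ) - b := by
  refine Primrec.encode_iff.mp ?_
  -- For a < b the difference is `Int.negSucc (b - a - 1)`, with code 2(b-a-1)+1 = 2(b-a)-1.
  have h : Primrec fun p : ℕ × ℕ => if p.2 ≤ p.1 then 2 * (p.1 - p.2) else 2 * (p.2 - p.1) - 1 :=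
    Primrec.ite (Primrec.nat_le.comp Primrec.snd Primrec.fst)
      (Primrec.nat_mul.comp (Primrec.const 2) (Primrec.nat_sub.comp Primrec.fst Primrec.snd))
      (Primrec.nat_sub.comp
        (Primrec.nat_mul.comp (Primrec.const 2) (Primrec.nat_sub.comp Primrec.snd Primrec.fst))
        (Primrec.const 1))
  refine h.of_eq fun p => ?_
  beta_reduce
  split_ifs with hp
  · rw [← Int.natCast_sub hp]
    exact (encode_ofNat _).symm
  · have : ((p.1 : ℤ) - p.2) = Int.negSucc (p.2 - p.1 - 1) := by
      rw [Int.negSucc_eq]; omega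
    rw [this, encode_negSucc]
    omega

/-- Each integer is the difference of its positive and negative parts, which reduces addition, and
likewise multiplication, to natural numbers and one subtraction. -/
theorem primrec_int_add : Primrec₂ fun a b : ℤ => a + b := by
  have h : Primrec fun p : ℤ × ℤ =>
      ((p.1.toNat + p.2.toNat : ℕ) : ℤ) - ((-p.1).toNat + (-p.2).toNat : ℕ) :=
    primrec_natCast_sub.comp
      (Primrec.nat_add.comp (primrec_toNat.comp Primrec.fst) (primrec_toNat.comp Primrec.snd))
      (Primrec.nat_add.comp (primrec_neg_toNat.comp Primrec.fst)
        (primrec_neg_toNat.comp Primrec.snd))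
  exact h.of_eq fun p => by beta_reduce; omega

theorem primrec_int_mul : Primrec₂ fun a b : ℤ => a * b := by
  have h : Primrec fun p : ℤ × ℤ =>
      ((p.1.toNat * p.2.toNat + (-p.1).toNat * (-p.2).toNat : ℕ) : ℤ)
        - (p.1.toNat * (-p.2).toNat + (-p.1).toNat * p.2.toNat : ℕ) := by
    have a := primrec_toNat.comp (Primrec.fst (α := ℤ) (β := ℤ))
    have b := primrec_toNat.comp (Primrec.snd (α := ℤ) (β := ℤ))
    have c := primrec_neg_toNat.comp (Primrec.fst (α := ℤ) (β := ℤ))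
    have d := primrec_neg_toNat.comp (Primrec.snd (α := ℤ) (β := ℤ))
    exact primrec_natCast_sub.comp
      (Primrec.nat_add.comp (Primrec.nat_mul.comp a b) (Primrec.nat_mul.comp c d))
      (Primrec.nat_add.comp (Primrec.nat_mul.comp a d) (Primrec.nat_mul.comp c b))
  refine h.of_eq fun p => ?_
  have h1 : p.1 = p.1.toNat - (-p.1).toNat := by omega
  have h2 : p.2 = p.2.toNat - (-p.2).toNat := by omega
  conv_rhs => rw [h1, h2]
  push_cast
  ring

/-- Addition of lists of coefficients. -/
def listAdd (p q : List ℤ) : List ℤ :=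
  (List.range (p.length + q.length)).map fun i => p.getD i 0 + q.getD i 0

/-- Multiplication of lists of coefficients. -/
def listMul (p q : List ℤ) : List ℤ :=
  p.foldr (fun a r => listAdd (q.map (a * ·)) (0 :: r)) []

theorem primrec_listAdd : Primrec₂ listAdd := by
  refine Primrec.list_map (Primrec.list_range.comp (Primrec.nat_add.comp
    (Primrec.list_length.comp Primrec.fst) (Primrec.list_length.comp Primrec.snd))) ?_
  exact primrec_int_add.comp
    ((Primrec.list_getD 0).comp (Primrec.fst.comp Primrec.fst) Primrec.snd)
    ((Primrec.list_getD 0).comp (Primrec.snd.comp Primrec.fst) Primrec.snd)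

theorem primrec_listMul : Primrec₂ listMul := by
  refine Primrec.list_foldr (f := fun x : List ℤ × List ℤ => x.1) (g := fun _ => [])
    (h := fun x y => listAdd (x.2.map (y.1 * ·)) (0 :: y.2)) Primrec.fst (Primrec.const [])
    (primrec_listAdd.comp ?_ ?_)
  · refine Primrec.list_map (Primrec.snd.comp Primrec.fst) ?_
    exact primrec_int_mul.comp (Primrec.fst.comp (Primrec.snd.comp Primrec.fst)) Primrec.snd
  · exact Primrec.list_cons.comp (Primrec.const 0) (Primrec.snd.comp Primrec.snd)

theorem toPoly_nil : toPoly [] = 0 := rfl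

theorem toPoly_cons (a : ℤ) (l : List ℤ) : toPoly (a :: l) = C a + X * toPoly l := rfl

theorem coeff_toPoly (l : List ℤ) (i : ℕ) : (toPoly l).coeff i = l.getD i 0 := by
  induction l generalizing i with
  | nil => simp [toPoly_nil]
  | cons a l ih =>
    rw [toPoly_cons]
    cases i with
    | zero => simp
    | succ i => rw [coeff_add, coeff_C_succ, coeff_X_mul, ih]; simp

theorem toPoly_listAdd (p q : List ℤ) : toPoly (listAdd p q) = toPoly p + toPoly q := by
  ext i
  rw [coeff_add, coeff_toPoly, coeff_toPoly, coeff_toPoly, listAdd]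
  by_cases h : i < p.length + q.length
  · rw [List.getD_eq_getElem _ _ (by simpa using h)]
    simp
  · rw [List.getD_eq_default _ _ (by simpa using h), List.getD_eq_default _ _ (by omega),
      List.getD_eq_default _ _ (by omega), add_zero]

theorem toPoly_map_mul (a : ℤ) (q : List ℤ) : toPoly (q.map (a * ·)) = C a * toPoly q := by
  induction q with
  | nil => simp [toPoly_nil]
  | cons b q ih => rw [List.map_cons, toPoly_cons, toPoly_cons, ih, C_mul]; ring

theorem toPoly_listMul (p q : List ℤ) : toPoly (listMul p q) = toPoly p * toPoly q := by
  induction p with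
  | nil => simp [listMul, toPoly_nil]
  | cons a p ih =>
    have : listMul (a :: p) q = listAdd (q.map (a * ·)) (0 :: listMul p q) := rfl
    rw [this, toPoly_listAdd, toPoly_map_mul, toPoly_cons, toPoly_cons, ih, C_0]
    ring

theorem toPoly_surjective : Function.Surjective toPoly := by
  intro p
  refine ⟨(List.range (p.natDegree + 1)).map p.coeff, ?_⟩
  ext i
  rw [coeff_toPoly]
  by_cases h : i < p.natDegree + 1
  · rw [List.getD_eq_getElem _ _ (by simpa using h)]
    simp
  · rw [List.getD_eq_default _ _ (by simpa using h), coeff_eq_zero_of_natDegree_lt (by omega)]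

/-- A family of integer polynomials with primitive recursive lists of coefficients. -/
def PolyPrimrec {β : Type*} [Primcodable β] (F : β → ℤ[X]) : Prop :=
  ∃ f : β → List ℤ, Primrec f ∧ ∀ b, toPoly (f b) = F b

namespace PolyPrimrec

variable {β : Type*} [Primcodable β] {F G : β → ℤ[X]}

theorem const (p : ℤ[X]) : PolyPrimrec fun _ : β => p := by
  obtain ⟨l, rfl⟩ := toPoly_surjective p
  exact ⟨fun _ => l, Primrec.const l, fun _ => rfl⟩

theorem add (hF : PolyPrimrec F) (hG : PolyPrimrec G) : PolyPrimrec fun b => F b + G b := by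
  obtain ⟨f, hf, hf'⟩ := hF
  obtain ⟨g, hg, hg'⟩ := hG
  exact ⟨_, primrec_listAdd.comp hf hg, fun b => by rw [toPoly_listAdd, hf', hg']⟩

theorem mul (hF : PolyPrimrec F) (hG : PolyPrimrec G) : PolyPrimrec fun b => F b * G b := by
  obtain ⟨f, hf, hf'⟩ := hF
  obtain ⟨g, hg, hg'⟩ := hG
  exact ⟨_, primrec_listMul.comp hf hg, fun b => by rw [toPoly_listMul, hf', hg']⟩

theorem sub (hF : PolyPrimrec F) (hG : PolyPrimrec G) : PolyPrimrec fun b => F b - G b := by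
  have := hF.add ((const (-1)).mul hG)
  simpa [← sub_eq_add_neg] using this

theorem pow (hF : PolyPrimrec F) (n : ℕ) : PolyPrimrec fun b => F b ^ n := by
  induction n with
  | zero => simpa using const 1
  | succ n ih => simpa only [pow_succ] using ih.mul hF

theorem prod {ι : Type*} (s : Finset ι) {F : ι → β → ℤ[X]} (h : ∀ i, PolyPrimrec (F i)) :
    PolyPrimrec fun b => ∏ i ∈ s, F i b := by
  classical
  induction s using Finset.induction_on with
  | empty => simpa using const 1
  | insert a s ha ih => simpa only [Finset.prod_insert ha] using (h a).mul ih

theorem toPoly_of {f : β → List ℤ} (hf : Primrec f) : PolyPrimrec fun b => toPoly (f b) :=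
  ⟨f, hf, fun _ => rfl⟩

theorem cons {F : ℕ → ℤ[X]} (p : ℤ[X]) (hF : PolyPrimrec F) :
    PolyPrimrec fun n => (Nat.casesOn n p F : ℤ[X]) := by
  obtain ⟨f, hf, hf'⟩ := hF
  obtain ⟨l, rfl⟩ := toPoly_surjective p
  refine ⟨_, Primrec.nat_casesOn₁ l hf, fun n => ?_⟩
  cases n with
  | zero => rfl
  | succ n => exact hf' n

end PolyPrimrec

/-- Simultaneous primitive recursion for three families of polynomials. -/
theorem PolyPrimrec.rec {a b c : ℕ → ℤ[X]} (f g h : ℤ[X] → ℤ[X] → ℤ[X] → ℤ[X])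
    (hf : PolyPrimrec fun s : List ℤ × List ℤ × List ℤ =>
      f (toPoly s.1) (toPoly s.2.1) (toPoly s.2.2))
    (hg : PolyPrimrec fun s : List ℤ × List ℤ × List ℤ =>
      g (toPoly s.1) (toPoly s.2.1) (toPoly s.2.2))
    (hh : PolyPrimrec fun s : List ℤ × List ℤ × List ℤ =>
      h (toPoly s.1) (toPoly s.2.1) (toPoly s.2.2))
    (ha : ∀ n, a (n + 1) = f (a n) (b n) (c n)) (hb : ∀ n, b (n + 1) = g (a n) (b n) (c n))
    (hc : ∀ n, c (n + 1) = h (a n) (b n) (c n)) :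
    PolyPrimrec a ∧ PolyPrimrec b ∧ PolyPrimrec c := by
  obtain ⟨f', hf', ef⟩ := hf
  obtain ⟨g', hg', eg⟩ := hg
  obtain ⟨h', hh', eh⟩ := hh
  obtain ⟨la, hla⟩ := toPoly_surjective (a 0)
  obtain ⟨lb, hlb⟩ := toPoly_surjective (b 0)
  obtain ⟨lc, hlc⟩ := toPoly_surjective (c 0)
  let S : ℕ → List ℤ × List ℤ × List ℤ := fun n =>
    Nat.rec (la, lb, lc) (fun _ s => (f' s, g' s, h' s)) n
  have hS : Primrec S := Primrec.nat_rec₁ _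
    ((hf'.pair (hg'.pair hh')).comp Primrec.snd)
  have key : ∀ n, toPoly (S n).1 = a n ∧ toPoly (S n).2.1 = b n ∧ toPoly (S n).2.2 = c n := by
    intro n
    induction n with
    | zero => exact ⟨hla, hlb, hlc⟩
    | succ n ih =>
      obtain ⟨h1, h2, h3⟩ := ih
      refine ⟨?_, ?_, ?_⟩
      · rw [ha, ← h1, ← h2, ← h3]; exact ef (S n)
      · rw [hb, ← h1, ← h2, ← h3]; exact eg (S n)
      · rw [hc, ← h1, ← h2, ← h3]; exact eh (S n)
  exact ⟨⟨_, Primrec.fst.comp hS, fun n => (key n).1⟩,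
    ⟨_, Primrec.fst.comp (Primrec.snd.comp hS), fun n => (key n).2.1⟩,
    ⟨_, Primrec.snd.comp (Primrec.snd.comp hS), fun n => (key n).2.2⟩⟩

/-! ### Computable sequences in ℚ(m), as quotients of sequences in ℤ[m] -/

/-- The inclusion of `ℤ[m]` in `ℚ(m)`. -/
noncomputable def polyToQm : ℤ[X] →+* Qm := (aeval mm : ℤ[X] →ₐ[ℤ] Qm).toRingHom

theorem toQm_eq (l : List ℤ) : toQm l = polyToQm (toPoly l) := rfl

theorem polyToQm_eq (p : ℤ[X]) :
    polyToQm p = algebraMap ℚ[X] Qm (p.map (Int.castRingHom ℚ)) := by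
  have : polyToQm = (algebraMap ℚ[X] Qm).comp (mapRingHom (Int.castRingHom ℚ)) := by
    ext
    · simp [polyToQm]
    · simp [polyToQm]
  rw [this]; rfl

theorem polyToQm_injective : Function.Injective polyToQm := by
  intro p q h
  rw [polyToQm_eq, polyToQm_eq] at h
  exact map_injective _ (RingHom.injective_int _) (FaithfulSMul.algebraMap_injective _ _ h)

theorem polyToQm_ne_zero {p : ℤ[X]} (hp : p ≠ 0) : polyToQm p ≠ 0 := by
  rwa [Ne, map_eq_zero_iff _ polyToQm_injective]

theorem exists_polyToQm_div (x : Qm) : ∃ p q : ℤ[X], q ≠ 0 ∧ x = polyToQm p / polyToQm q := by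
  have key : ∀ r : ℚ[X], ∃ (b : ℤ) (p : ℤ[X]), b ≠ 0 ∧ polyToQm p = b * algebraMap ℚ[X] Qm r := by
    intro r
    obtain ⟨b, hb, e⟩ := IsLocalization.integerNormalization_spec (nonZeroDivisors ℤ) r
    refine ⟨b, IsLocalization.integerNormalization (nonZeroDivisors ℤ) r,
      nonZeroDivisors.ne_zero hb, ?_⟩
    rw [polyToQm_eq, ← algebraMap_int_eq, e]
    simp
  obtain ⟨b, p, hb, hp⟩ := key x.num
  obtain ⟨c, q, hc, hq⟩ := key x.denom
  have hb' : (b : Qm) ≠ 0 := Int.cast_ne_zero.mpr hb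
  have hc' : (c : Qm) ≠ 0 := Int.cast_ne_zero.mpr hc
  have hd : algebraMap ℚ[X] Qm x.denom ≠ 0 := by
    rw [Ne, FaithfulSMul.algebraMap_eq_zero_iff]
    exact x.denom_ne_zero
  refine ⟨c * p, b * q, mul_ne_zero (Int.cast_ne_zero.mpr hb) ?_, ?_⟩
  · rintro rfl
    rw [map_zero] at hq
    exact mul_ne_zero hc' hd hq.symm
  · rw [map_mul, map_mul, map_intCast, map_intCast, hp, hq]
    conv_lhs => rw [← x.num_div_denom]
    field_simp

/-- A sequence of rational functions whose numerators and denominators can be chosen with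
primitive recursive lists of coefficients. -/
def RatPrimrec (F : ℕ → Qm) : Prop :=
  ∃ p q : ℕ → ℤ[X], PolyPrimrec p ∧ PolyPrimrec q ∧ (∀ n, q n ≠ 0) ∧
    ∀ n, F n = polyToQm (p n) / polyToQm (q n)

namespace RatPrimrec

variable {F G : ℕ → Qm}

theorem const (x : Qm) : RatPrimrec fun _ => x := by
  obtain ⟨p, q, hq, e⟩ := exists_polyToQm_div x
  exact ⟨_, _, .const p, .const q, fun _ => hq, fun _ => e⟩

theorem add (hF : RatPrimrec F) (hG : RatPrimrec G) : RatPrimrec fun n => F n + G n := by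
  obtain ⟨p, q, hp, hq, h0, e⟩ := hF
  obtain ⟨p', q', hp', hq', h0', e'⟩ := hG
  refine ⟨_, _, (hp.mul hq').add (hq.mul hp'), hq.mul hq', fun n => mul_ne_zero (h0 n) (h0' n),
    fun n => ?_⟩
  beta_reduce
  rw [e, e', div_add_div _ _ (polyToQm_ne_zero (h0 n)) (polyToQm_ne_zero (h0' n))]
  simp only [map_add, map_mul]

theorem mul (hF : RatPrimrec F) (hG : RatPrimrec G) : RatPrimrec fun n => F n * G n := by
  obtain ⟨p, q, hp, hq, h0, e⟩ := hF
  obtain ⟨p', q', hp', hq', h0', e'⟩ := hG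
  refine ⟨_, _, hp.mul hp', hq.mul hq', fun n => mul_ne_zero (h0 n) (h0' n), fun n => ?_⟩
  beta_reduce
  rw [e, e', div_mul_div_comm]
  simp only [map_mul]

theorem neg (hF : RatPrimrec F) : RatPrimrec fun n => -F n := by
  simpa using (const (-1)).mul hF

theorem sub (hF : RatPrimrec F) (hG : RatPrimrec G) : RatPrimrec fun n => F n - G n := by
  simpa [sub_eq_add_neg] using hF.add hG.neg

theorem pow (hF : RatPrimrec F) (k : ℕ) : RatPrimrec fun n => F n ^ k := by
  induction k with
  | zero => simpa using const 1
  | succ n ih => simpa only [pow_succ] using ih.mul hF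

theorem div (hF : RatPrimrec F) (hG : RatPrimrec G) (h : ∀ n, G n ≠ 0) :
    RatPrimrec fun n => F n / G n := by
  obtain ⟨p, q, hp, hq, h0, e⟩ := hF
  obtain ⟨p', q', hp', hq', h0', e'⟩ := hG
  refine ⟨_, _, hp.mul hq', hq.mul hp', fun n => mul_ne_zero (h0 n) ?_, fun n => ?_⟩
  · intro h0
    apply h n
    rw [e', h0, map_zero, zero_div]
  · beta_reduce
    rw [e, e', div_div_div_eq]
    simp only [map_mul]

/-- The sequence with an arbitrary first term prepended. -/
theorem cons (x : Qm) (hF : RatPrimrec F) :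
    RatPrimrec fun n => Nat.casesOn n x F := by
  obtain ⟨p, q, hp, hq, h0, e⟩ := hF
  obtain ⟨a, b, hb, e'⟩ := exists_polyToQm_div x
  refine ⟨_, _, hp.cons a, hq.cons b, fun n => ?_, fun n => ?_⟩
  · cases n with
    | zero => exact hb
    | succ n => exact h0 n
  · cases n with
    | zero => exact e'
    | succ n => exact e n

/-- The product of all denominators serves. No gcd is taken, so the construction stays primitive
recursive. -/
theorem exists_common_denominator {ι : Type*} [Fintype ι] {F : ι → ℕ → Qm}
    (hF : ∀ i, RatPrimrec (F i)) : ∃ (d : ℕ → ℤ[X]) (p : ι → ℕ → ℤ[X]),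
      (∀ n, d n ≠ 0) ∧ (∀ i, PolyPrimrec (p i)) ∧
      ∀ i n, polyToQm (p i n) = polyToQm (d n) * F i n := by
  classical
  choose p q hp hq h0 e using hF
  refine ⟨fun n => ∏ i, q i n, fun i n => p i n * ∏ j ∈ Finset.univ.erase i, q j n,
    fun n => Finset.prod_ne_zero_iff.mpr fun i _ => h0 i n,
    fun i => (hp i).mul (PolyPrimrec.prod _ hq), fun i n => ?_⟩
  have h1 := polyToQm_ne_zero (h0 i n)
  beta_reduce
  rw [← Finset.mul_prod_erase _ _ (Finset.mem_univ i), e, map_mul, map_mul]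
  field_simp

end RatPrimrec

/-! ### The parametric solutions -/

section Solution

variable {L : Type*} [Field L]

theorem powerEq_smul_iff {k : ℕ} {x y : Fin 4 → L} {c : L} (hc : c ≠ 0) :
    PowerEq k (fun i => c * x i) (fun i => c * y i) ↔ PowerEq k x y := by
  unfold PowerEq
  simp only [mul_pow]
  have hc' := pow_ne_zero 2 (pow_ne_zero k hc)
  constructor
  · intro h
    apply mul_left_cancel₀ hc'
    linear_combination h
  · intro h
    linear_combination (c ^ k) ^ 2 * h

/-- The ratio `h / S₁²`. -/
def ratioH (m u : L) : L :=
  -2 * u * ((m + 1) * (m ^ 2 + 1) * u - m * (m ^ 2 + 3)) /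
    ((3 * m ^ 2 + 1) * ((m + 1) * u ^ 2 - m + 1))

theorem hOf_eq (m S u : L) : hOf m S u = S ^ 2 * ratioH m u := by
  rw [hOf, ratioH]; ring

/-- The four pairs `(X₁, X₂)`, `(X₃, X₄)`, `(Y₁, Y₂)`, `(Y₃, Y₄)` for `S₁ = 1`. -/
def rootX (m u : L) : Fin 4 → L :=
  ![(ratioH m u - (m ^ 2 - 1) / (3 * m ^ 2 + 1)
      + m * (ratioH m u + (m ^ 2 - 1) / (3 * m ^ 2 + 1))) / 2,
    (ratioH m u - (m ^ 2 - 1) / (3 * m ^ 2 + 1)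
      - m * (ratioH m u + (m ^ 2 - 1) / (3 * m ^ 2 + 1))) / 2,
    (1 - ratioH m u + (m * ratioH m u + m * (m ^ 2 + 3) / (3 * m ^ 2 + 1))) / 2,
    (1 - ratioH m u - (m * ratioH m u + m * (m ^ 2 + 3) / (3 * m ^ 2 + 1))) / 2]

/-- The root of the first discriminant is its value m(m²+3)/(3m²+1) at h = 0 plus slope (m-1)/u
times h; that of the second is v over the denominator of h. -/
def rootY (m u v : L) : Fin 4 → L :=
  ![(1 + (m * (m ^ 2 + 3) / (3 * m ^ 2 + 1) + (m - 1) * ratioH m u / u)) / 2,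
    (1 - (m * (m ^ 2 + 3) / (3 * m ^ 2 + 1) + (m - 1) * ratioH m u / u)) / 2,
    (-((m ^ 2 - 1) / (3 * m ^ 2 + 1))
      + v / ((3 * m ^ 2 + 1) * ((m + 1) * u ^ 2 - m + 1))) / 2,
    (-((m ^ 2 - 1) / (3 * m ^ 2 + 1))
      - v / ((3 * m ^ 2 + 1) * ((m + 1) * u ^ 2 - m + 1))) / 2]

/-- The solution with the given roots, up to scaling. -/
def solX (m u v : L) : Fin 4 → L :=
  ![rootY m u v 0 * rootY m u v 2, -(rootX m u 1 * rootY m u v 2), rootX m u 0, -rootY m u v 0]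

def solY (m u v : L) : Fin 4 → L :=
  ![rootY m u v 2 * rootY m u v 0, -(rootX m u 3 * rootY m u v 0), -rootX m u 2, rootY m u v 2]

/-- The products of the pairs of roots, for `S₁ = 1`. -/
def prodS (m h : L) : L :=
  -(m ^ 2 - 1) * (h ^ 2 + (1 - (m ^ 2 - 1) / (3 * m ^ 2 + 1)) * h
    + ((m ^ 2 - 1) / (3 * m ^ 2 + 1)) ^ 2) / 4

variable {m u v : L}

theorem ratioH_spec (hδ : (3 * m ^ 2 + 1) * ((m + 1) * u ^ 2 - m + 1) ≠ 0) :
    (3 * m ^ 2 + 1) * ((m + 1) * u ^ 2 - m + 1) * ratioH m u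
      = -2 * u * ((m + 1) * (m ^ 2 + 1) * u - m * (m ^ 2 + 3)) := by
  rw [ratioH, mul_div_cancel₀ _ hδ]

/-- With k = (m²-1)/(3m²+1) the discriminant (h-k)² - 4p equals m²(h+k)²; this is where k comes
from. -/
theorem rootX_prod_left (h2 : (2 : L) ≠ 0) (h3 : 3 * m ^ 2 + 1 ≠ 0) :
    rootX m u 0 * rootX m u 1 = prodS m (ratioH m u) := by
  have h4 : (4 : L) ≠ 0 := by
    rw [show (4 : L) = 2 * 2 by norm_num]; exact mul_ne_zero h2 h2
  simp only [rootX, prodS, Matrix.cons_val_zero, Matrix.cons_val_one]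
  generalize ratioH m u = h
  obtain ⟨w, hw⟩ : ∃ w, w = 3 * m ^ 2 + 1 := ⟨_, rfl⟩
  rw [← hw] at h3 ⊢
  field_simp
  rw [hw]
  ring

theorem rootX_prod_right (h2 : (2 : L) ≠ 0) (h3 : 3 * m ^ 2 + 1 ≠ 0) :
    rootX m u 2 * rootX m u 3 = prodS m (ratioH m u) - ratioH m u := by
  have h4 : (4 : L) ≠ 0 := by
    rw [show (4 : L) = 2 * 2 by norm_num]; exact mul_ne_zero h2 h2
  simp only [rootX, prodS, Matrix.cons_val]
  generalize ratioH m u = h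
  obtain ⟨w, hw⟩ : ∃ w, w = 3 * m ^ 2 + 1 := ⟨_, rfl⟩
  rw [← hw] at h3 ⊢
  field_simp
  rw [hw]
  ring

/-- The condition 1 - 4p = w² is a conic in (h, w) with the rational point h = 0, because (3m²+1)² +
(m²-1)³ = m²(m²+3)². `ratioH` is the second intersection with the line of slope (m-1)/u, so the
difference of the two sides is h times the relation `ratioH_spec`. -/
theorem rootY_prod_left (h2 : (2 : L) ≠ 0) (h3 : 3 * m ^ 2 + 1 ≠ 0) (hu : u ≠ 0)
    (hδ : (3 * m ^ 2 + 1) * ((m + 1) * u ^ 2 - m + 1) ≠ 0) :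
    rootY m u v 0 * rootY m u v 1 = prodS m (ratioH m u) := by
  have h4 : (4 : L) ≠ 0 := by
    rw [show (4 : L) = 2 * 2 by norm_num]; exact mul_ne_zero h2 h2
  have hs := ratioH_spec hδ
  simp only [rootY, prodS, Matrix.cons_val_zero, Matrix.cons_val_one]
  generalize ratioH m u = h at *
  obtain ⟨w, hw⟩ : ∃ w, w = 3 * m ^ 2 + 1 := ⟨_, rfl⟩
  rw [← hw] at h3 hs ⊢
  field_simp
  rw [hw] at hs ⊢
  linear_combination (4 * h * (m - 1) * (3 * m ^ 2 + 1)) * hs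

/-- Substituting h as a function of u into the last discriminant k² - 4(p-h) gives φ(u) over the
square of the denominator of h. This is the only place where the quartic is needed. -/
theorem rootY_prod_right (h2 : (2 : L) ≠ 0) (h3 : 3 * m ^ 2 + 1 ≠ 0)
    (hδ : (3 * m ^ 2 + 1) * ((m + 1) * u ^ 2 - m + 1) ≠ 0) (hv : v ^ 2 = phi m u) :
    rootY m u v 2 * rootY m u v 3 = prodS m (ratioH m u) - ratioH m u := by
  have h4 : (4 : L) ≠ 0 := by
    rw [show (4 : L) = 2 * 2 by norm_num]; exact mul_ne_zero h2 h2
  have h5 := right_ne_zero_of_mul hδ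
  rw [phi_eq] at hv
  simp only [rootY, prodS, Matrix.cons_val, ratioH]
  obtain ⟨w, hw⟩ : ∃ w, w = 3 * m ^ 2 + 1 := ⟨_, rfl⟩
  obtain ⟨z, hz⟩ : ∃ z, z = (m + 1) * u ^ 2 - m + 1 := ⟨_, rfl⟩
  rw [← hw, ← hz]
  rw [← hw] at h3
  rw [← hz] at h5
  field_simp
  rw [hw, hz]
  linear_combination -4 * hv

theorem rootX_sum_left (h2 : (2 : L) ≠ 0) : rootX m u 0 + rootX m u 1
    = ratioH m u - (m ^ 2 - 1) / (3 * m ^ 2 + 1) := by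
  simp only [rootX, Matrix.cons_val_zero, Matrix.cons_val_one]
  field_simp
  ring

theorem rootX_sum_right (h2 : (2 : L) ≠ 0) : rootX m u 2 + rootX m u 3 = 1 - ratioH m u := by
  simp only [rootX, Matrix.cons_val]
  field_simp
  ring

theorem rootY_sum_left (h2 : (2 : L) ≠ 0) : rootY m u v 0 + rootY m u v 1 = 1 := by
  simp only [rootY, Matrix.cons_val_zero, Matrix.cons_val_one]
  field_simp
  ring

theorem rootY_sum_right (h2 : (2 : L) ≠ 0) : rootY m u v 2 + rootY m u v 3
    = -((m ^ 2 - 1) / (3 * m ^ 2 + 1)) := by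
  simp only [rootY, Matrix.cons_val]
  field_simp
  ring

/-- Sums of `k`-th powers, for odd `k`, in terms of the solution. -/
theorem powerEq_sol_iff {k : ℕ} (hk : Odd k) {X Y : Fin 4 → L}
    (h0 : Y 0 ≠ 0) (h2 : Y 2 ≠ 0) (hl : X 0 * X 1 = Y 0 * Y 1) (hr : X 2 * X 3 = Y 2 * Y 3) :
    PowerEq k ![Y 0 * Y 2, -(X 1 * Y 2), X 0, -Y 0] ![Y 2 * Y 0, -(X 3 * Y 0), -X 2, Y 2]
      ↔ X 0 ^ k + X 1 ^ k + X 2 ^ k + X 3 ^ k = Y 0 ^ k + Y 1 ^ k + Y 2 ^ k + Y 3 ^ k := by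
  have hl' : X 0 ^ k * X 1 ^ k = Y 0 ^ k * Y 1 ^ k := by rw [← mul_pow, hl, mul_pow]
  have hr' : X 2 ^ k * X 3 ^ k = Y 2 ^ k * Y 3 ^ k := by rw [← mul_pow, hr, mul_pow]
  have h0' := pow_ne_zero k h0
  have h2' := pow_ne_zero k h2
  simp only [PowerEq, Matrix.cons_val, hk.neg_pow, mul_pow]
  constructor
  · intro h
    apply mul_left_cancel₀ (mul_ne_zero h0' h2')
    linear_combination h + Y 2 ^ k * hl' + Y 0 ^ k * hr'
  · intro h
    linear_combination Y 0 ^ k * Y 2 ^ k * h - Y 2 ^ k * hl' - Y 0 ^ k * hr'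

/-- Both sides of the equation, in terms of the roots. -/
theorem left_side_sol {k : ℕ} (hk : Odd k) {X Y : Fin 4 → L} (hl : X 0 * X 1 = Y 0 * Y 1) :
    ((Y 0 * Y 2) ^ k + (-(X 1 * Y 2)) ^ k) * (X 0 ^ k + (-Y 0) ^ k)
      = Y 0 ^ k * Y 2 ^ k * (X 0 ^ k + X 1 ^ k - Y 0 ^ k - Y 1 ^ k) := by
  have hl' : X 0 ^ k * X 1 ^ k = Y 0 ^ k * Y 1 ^ k := by rw [← mul_pow, hl, mul_pow]
  simp only [hk.neg_pow, mul_pow]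
  linear_combination -Y 2 ^ k * hl'

theorem add_pow_five (a b : L) :
    a ^ 5 + b ^ 5 = (a + b) ^ 5 - 5 * (a + b) ^ 3 * (a * b) + 5 * (a + b) * (a * b) ^ 2 := by
  ring

theorem add_pow_three (a b : L) : a ^ 3 + b ^ 3 = (a + b) ^ 3 - 3 * (a + b) * (a * b) := by
  ring

/-- A pair contributes a polynomial in its sum and product, so v and u drop out and an identity in h
and m remains. -/
theorem roots_pow_five (h2 : (2 : L) ≠ 0) (h3 : 3 * m ^ 2 + 1 ≠ 0) (hu : u ≠ 0)
    (hδ : (3 * m ^ 2 + 1) * ((m + 1) * u ^ 2 - m + 1) ≠ 0) (hv : v ^ 2 = phi m u) :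
    rootX m u 0 ^ 5 + rootX m u 1 ^ 5 + rootX m u 2 ^ 5 + rootX m u 3 ^ 5
      = rootY m u v 0 ^ 5 + rootY m u v 1 ^ 5 + rootY m u v 2 ^ 5 + rootY m u v 3 ^ 5 := by
  have h4 : (4 : L) ≠ 0 := by
    rw [show (4 : L) = 2 * 2 by norm_num]; exact mul_ne_zero h2 h2
  rw [add_assoc (rootX m u 0 ^ 5 + _), add_assoc (rootY m u v 0 ^ 5 + _), add_pow_five,
    add_pow_five (rootX m u 2), add_pow_five (rootY m u v 0), add_pow_five (rootY m u v 2),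
    rootX_sum_left h2, rootX_sum_right h2, rootY_sum_left h2, rootY_sum_right h2,
    rootX_prod_left h2 h3, rootX_prod_right h2 h3, rootY_prod_left h2 h3 hu hδ,
    rootY_prod_right h2 h3 hδ hv, prodS]
  generalize ratioH m u = h
  obtain ⟨w, hw⟩ : ∃ w, w = 3 * m ^ 2 + 1 := ⟨_, rfl⟩
  rw [← hw] at h3 ⊢
  field_simp
  rw [hw]
  ring

/-- The product p cancels because the sums satisfy s₁ + t₁ = S₁ + T₁. The explicit factors show when
exponent 3 fails. -/
theorem roots_pow_three (h2 : (2 : L) ≠ 0) (h3 : 3 * m ^ 2 + 1 ≠ 0) (hu : u ≠ 0)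
    (hδ : (3 * m ^ 2 + 1) * ((m + 1) * u ^ 2 - m + 1) ≠ 0) (hv : v ^ 2 = phi m u) :
    rootX m u 0 ^ 3 + rootX m u 1 ^ 3 + rootX m u 2 ^ 3 + rootX m u 3 ^ 3
      - (rootY m u v 0 ^ 3 + rootY m u v 1 ^ 3 + rootY m u v 2 ^ 3 + rootY m u v 3 ^ 3)
      = 3 * ((m ^ 2 - 1) / (3 * m ^ 2 + 1)) * ratioH m u
        * (1 + (m ^ 2 - 1) / (3 * m ^ 2 + 1) - ratioH m u) := by
  rw [add_assoc (rootX m u 0 ^ 3 + _), add_assoc (rootY m u v 0 ^ 3 + _), add_pow_three,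
    add_pow_three (rootX m u 2), add_pow_three (rootY m u v 0), add_pow_three (rootY m u v 2),
    rootX_sum_left h2, rootX_sum_right h2, rootY_sum_left h2, rootY_sum_right h2,
    rootX_prod_left h2 h3, rootX_prod_right h2 h3, rootY_prod_left h2 h3 hu hδ,
    rootY_prod_right h2 h3 hδ hv]
  ring

/-- The solution has the prescribed sums and products. -/
theorem obtainedFrom_sol {c : L} (h2 : (2 : L) ≠ 0) (h3 : 3 * m ^ 2 + 1 ≠ 0) (hu : u ≠ 0)
    (hδ : (3 * m ^ 2 + 1) * ((m + 1) * u ^ 2 - m + 1) ≠ 0) (hv : v ^ 2 = phi m u)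
    (hh : ratioH m u ≠ 0) (hc : c ≠ 0) (h0 : rootY m u v 0 ≠ 0) (h2' : rootY m u v 2 ≠ 0) :
    ObtainedFrom m u (fun i => c * solX m u v i) (fun i => c * solY m u v i) := by
  have h4 : (4 : L) ≠ 0 := by
    rw [show (4 : L) = 2 * 2 by norm_num]; exact mul_ne_zero h2 h2
  -- Multiplying out the solution gives the roots times c²Y₁Y₃; as the normalised S₁ is 1, this
  -- factor is the actual S₁.
  obtain ⟨S, hS⟩ : ∃ S, S = c ^ 2 * (rootY m u v 0 * rootY m u v 2) := ⟨_, rfl⟩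
  have hS0 : S ≠ 0 := hS ▸ mul_ne_zero (pow_ne_zero _ hc) (mul_ne_zero h0 h2')
  obtain ⟨k, hk⟩ : ∃ k, k = (m ^ 2 - 1) / (3 * m ^ 2 + 1) := ⟨_, rfl⟩
  have hk' : m ^ 2 - 1 = k * (3 * m ^ 2 + 1) := by rw [hk, div_mul_cancel₀ _ h3]
  have sl := rootX_sum_left (m := m) (u := u) h2
  have sr := rootX_sum_right (m := m) (u := u) h2
  have Sl := rootY_sum_left (m := m) (u := u) (v := v) h2
  have Sr := rootY_sum_right (m := m) (u := u) (v := v) h2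
  have pl := rootX_prod_left (u := u) h2 h3
  have pr := rootX_prod_right (u := u) h2 h3
  have Pl := rootY_prod_left (v := v) h2 h3 hu hδ
  have Pr := rootY_prod_right h2 h3 hδ hv
  rw [← hk] at sl Sr
  -- D equals S₁⁴h(3k-1)/S₁² with the normalised h, so it is nonzero once h is; and k/(3k-1) =
  -- -(m²-1)/4 turns the prescribed s₂ into `prodS`.
  have h31 : (3 * k - 1) * (3 * m ^ 2 + 1) = -4 := by linear_combination -3 * hk'
  have h31' : 3 * k - 1 ≠ 0 := by
    intro h
    rw [h, zero_mul] at h31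
    exact h4 (by linear_combination h31)
  have e : prodS m (ratioH m u) * (3 * k - 1)
      = k * (ratioH m u ^ 2 + ratioH m u - ratioH m u * k + k ^ 2) := by
    rw [prodS, ← hk, div_mul_eq_mul_div, div_eq_iff h4]
    linear_combination -(ratioH m u ^ 2 + (1 - k) * ratioH m u + k ^ 2)
      * ((3 * k - 1) * hk' + k * h31)
  have eD : 2 * (S ^ 2 * ratioH m u) + 3 * (S * (ratioH m u - k) + S * (1 - ratioH m u))
      * (S * (1 - ratioH m u) - S) = S ^ 2 * ratioH m u * (3 * k - 1) := by ring
  have hD : S ^ 2 * ratioH m u * (3 * k - 1) ≠ 0 :=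
    mul_ne_zero (mul_ne_zero (pow_ne_zero _ hS0) hh) h31'
  refine ⟨S, hOf m S u, S * (ratioH m u - k), S * (1 - ratioH m u), S * (-k),
    S ^ 2 * prodS m (ratioH m u), S ^ 2 * (prodS m (ratioH m u) - ratioH m u), hS0, hδ, rfl,
    ?_, ?_, ?_, ?_, ?_, ?_, ?_, ?_, ?_, ?_, ?_, ?_, ?_, ?_⟩
  · rw [hOf_eq]; field_simp
  · rw [hOf_eq, eq_div_iff (mul_ne_zero h3 hS0)]; linear_combination S ^ 2 * hk'
  · ring
  · rw [hOf_eq, eD]; exact hD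
  · rw [hOf_eq, eD, eq_div_iff hD]; linear_combination S ^ 4 * ratioH m u * e
  · rw [hOf_eq, eD, eq_div_iff hD]; linear_combination S ^ 4 * ratioH m u * e
  all_goals
    simp only [solX, solY, Matrix.cons_val]
    generalize rootX m u 0 = X₁ at *
    generalize rootX m u 1 = X₂ at *
    generalize rootX m u 2 = X₃ at *
    generalize rootX m u 3 = X₄ at *
    generalize rootY m u v 0 = Y₁ at *
    generalize rootY m u v 1 = Y₂ at *
    generalize rootY m u v 2 = Y₃ at *
    generalize rootY m u v 3 = Y₄ at *
    generalize prodS m (ratioH m u) = p at *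
    generalize ratioH m u = h at *
    rw [hS]
  · linear_combination c ^ 2 * (Y₁ * Y₃) * sl
  · linear_combination (c ^ 2 * (Y₁ * Y₃)) ^ 2 * pl
  · linear_combination c ^ 2 * (Y₁ * Y₃) * sr
  · linear_combination (c ^ 2 * (Y₁ * Y₃)) ^ 2 * pr
  · linear_combination c ^ 2 * (Y₁ * Y₃) * Sl + c ^ 2 * Y₃ * (pl - Pl)
  · linear_combination (c ^ 2 * (Y₁ * Y₃)) ^ 2 * pl
  · linear_combination c ^ 2 * (Y₁ * Y₃) * Sr + c ^ 2 * Y₁ * (pr - Pr)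
  · linear_combination (c ^ 2 * (Y₁ * Y₃)) ^ 2 * pr

end Solution

section FunctionFields

/-! ### The function fields -/

/-- The polynomial is negative at every rational m in (0, 1), while a square of a rational function
is nonnegative wherever it is defined. -/
theorem phi_leading_not_square (z : Qm) : z ^ 2 ≠ mm ^ 6 - 26 * mm ^ 4 - 31 * mm ^ 2 - 8 := by
  intro h
  have hd : algebraMap ℚ[X] Qm z.denom ≠ 0 := by
    rw [Ne, FaithfulSMul.algebraMap_eq_zero_iff]
    exact z.denom_ne_zero
  rw [← z.num_div_denom, div_pow, div_eq_iff (pow_ne_zero _ hd)] at h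
  have h' : z.num ^ 2 = (X ^ 6 - 26 * X ^ 4 - 31 * X ^ 2 - 8) * z.denom ^ 2 := by
    apply FaithfulSMul.algebraMap_injective ℚ[X] Qm
    simpa [map_ofNat] using h
  apply z.denom_ne_zero
  -- At each such t the two sides have opposite signs unless the denominator vanishes, which would
  -- give it infinitely many roots.
  refine eq_zero_of_infinite_isRoot _ ((Set.Ioo_infinite (zero_lt_one' ℚ)).mono fun t ht => ?_)
  have e := congrArg (eval t) h'
  simp at e
  by_contra hne
  have hne' : eval t z.denom ≠ 0 := hne
  have h1 : 0 < (eval t z.denom) ^ 2 := by positivity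
  obtain ⟨h0, h2⟩ := ht
  have ht2 : t ^ 2 < 1 := by nlinarith
  have : t ^ 6 - 26 * t ^ 4 - 31 * t ^ 2 - 8 < 0 := by nlinarith [pow_pos h0 2, pow_pos h0 4]
  nlinarith [sq_nonneg (eval t z.num)]

theorem phiPoly_leadingCoeff :
    (phiPoly mm).leadingCoeff = (mm ^ 6 - 26 * mm ^ 4 - 31 * mm ^ 2 - 8) * (mm + 1) ^ 2 := by
  have hc : (phiPoly mm).coeff 4
      = (mm ^ 6 - 26 * mm ^ 4 - 31 * mm ^ 2 - 8) * (mm + 1) ^ 2 := by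
    have h : (phiPoly mm).coeff 4 = phiCoeff mm 4 := by
      simp only [phiPoly, finsetSum_coeff, coeff_C_mul_X_pow]
      rw [Finset.sum_eq_single 4]
      · exact if_pos rfl
      · exact fun b _ hb => if_neg fun h => hb (Fin.ext h.symm)
      · exact fun h => absurd (Finset.mem_univ _) h
    rw [h]
    rfl
  have hd : (phiPoly mm).natDegree ≤ 4 := by
    refine natDegree_sum_le_of_forall_le _ _ fun i _ => (natDegree_C_mul_X_pow_le _ _).trans ?_
    omega
  have h0 : (phiPoly mm).coeff 4 ≠ 0 := by
    rw [hc]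
    refine mul_ne_zero (fun h => ?_) (pow_ne_zero _ mm_add_one_ne_zero)
    exact phi_leading_not_square 0 (by rw [h]; ring)
  rw [leadingCoeff, le_antisymm hd (le_natDegree_of_ne_zero h0), hc]

/-- Compare leading coefficients: a nonzero b would make the leading coefficient of φ a square in
ℚ(m), and it is a nonsquare times (m+1)². -/
theorem eq_zero_of_sq_eq_sq_mul_phiPoly {a b : Qm[X]} (h : a ^ 2 = b ^ 2 * phiPoly mm) :
    b = 0 := by
  by_contra hb
  have e := congrArg leadingCoeff h
  rw [leadingCoeff_pow, leadingCoeff_mul, leadingCoeff_pow, phiPoly_leadingCoeff] at e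
  have hb' := leadingCoeff_ne_zero.mpr hb
  have h1 := mm_add_one_ne_zero
  refine phi_leading_not_square (a.leadingCoeff / (b.leadingCoeff * (mm + 1))) ?_
  rw [div_pow, div_eq_iff (pow_ne_zero _ (mul_ne_zero hb' h1)), e]
  ring

theorem aeval_UFun (p : Qm[X]) : aeval UFun p = algebraMap E.CoordinateRing E.FunctionField
    (WeierstrassCurve.Affine.CoordinateRing.mk E (C p)) := by
  have : (aeval UFun : Qm[X] →ₐ[Qm] E.FunctionField)
      = (IsScalarTower.toAlgHom Qm E.CoordinateRing E.FunctionField).comp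
        (IsScalarTower.toAlgHom Qm Qm[X] E.CoordinateRing) := by
    ext
    simp [UFun]
  rw [this]
  rfl

/-- 1 and V form a basis of the coordinate ring over the polynomials in U. -/
theorem UFun_VFun_independent {p q : Qm[X]} (h : aeval UFun p + aeval UFun q * VFun = 0) :
    p = 0 ∧ q = 0 := by
  rw [aeval_UFun, aeval_UFun, VFun, ← map_mul, ← map_add,
    FaithfulSMul.algebraMap_eq_zero_iff] at h
  apply WeierstrassCurve.Affine.CoordinateRing.smul_basis_eq_zero (W' := E)
  rw [WeierstrassCurve.Affine.CoordinateRing.smul, WeierstrassCurve.Affine.CoordinateRing.smul,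
    mul_one]
  exact h

theorem UFun_transcendental : Transcendental Qm UFun := by
  rw [transcendental_iff]
  intro p hp
  exact (UFun_VFun_independent (p := p) (q := 0) (by simp [hp])).1

local notation "M" => algebraMap Qm E.FunctionField mm

theorem cubic_map_a₄ : (cubic M).a₄ = algebraMap Qm E.FunctionField (cubic mm).a₄ := by
  simp only [cubic, map_mul, map_neg, map_add, map_sub, map_pow, map_one, map_ofNat]

theorem cubic_map_a₆ : (cubic M).a₆ = algebraMap Qm E.FunctionField (cubic mm).a₆ := by
  simp only [cubic, map_mul, map_neg, map_add, map_sub, map_pow, map_one, map_ofNat]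

theorem VFun_sq : VFun ^ 2 = UFun ^ 3 + (cubic M).a₄ * UFun + (cubic M).a₆ := by
  have h : WeierstrassCurve.Affine.CoordinateRing.mk E X ^ 2
      = WeierstrassCurve.Affine.CoordinateRing.mk E
        (C (X ^ 3 + C (cubic mm).a₄ * X + C (cubic mm).a₆)) := by
    rw [← map_pow]
    refine AdjoinRoot.mk_eq_mk.mpr ⟨1, ?_⟩
    simp [WeierstrassCurve.Affine.polynomial, cubic]
  rw [VFun, ← map_pow, h, ← aeval_UFun, cubic_map_a₄, cubic_map_a₆]
  simp

theorem psi_UFun_ne_zero : psi M UFun VFun ≠ 0 := by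
  intro h
  have h0 := (UFun_VFun_independent (q := C (mm ^ 2 - 1))
    (p := C (6 * (mm ^ 2 + 3) * (mm ^ 4 + 6 * mm ^ 2 + 1)) * X
      - C (72 * (mm ^ 2 - 1) * (mm ^ 2 + 3)
        * (35 * mm ^ 8 + 86 * mm ^ 6 + 108 * mm ^ 4 + 26 * mm ^ 2 + 1))) (by
      rw [psi] at h
      simp only [map_sub, map_mul, aeval_C, aeval_X, map_add, map_pow, map_one, map_ofNat]
      linear_combination h)).2
  rw [C_eq_zero, show mm ^ 2 - 1 = (mm - 1) * (mm + 1) by ring] at h0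
  exact mul_ne_zero mm_sub_one_ne_zero mm_add_one_ne_zero h0

theorem algebraMap_mm_ne_zero : M ≠ 0 :=
  (map_ne_zero_iff _ (FaithfulSMul.algebraMap_injective _ _)).mpr mm_ne_zero

theorem algebraMap_mm_sub_one_ne_zero : M - 1 ≠ 0 := by
  rw [← map_one (algebraMap Qm E.FunctionField), ← map_sub]
  exact (map_ne_zero_iff _ (FaithfulSMul.algebraMap_injective _ _)).mpr mm_sub_one_ne_zero

theorem algebraMap_mm_add_one_ne_zero : M + 1 ≠ 0 := by
  rw [← map_one (algebraMap Qm E.FunctionField), ← map_add]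
  exact (map_ne_zero_iff _ (FaithfulSMul.algebraMap_injective _ _)).mpr mm_add_one_ne_zero

theorem functionField_charZero : CharZero E.FunctionField :=
  charZero_of_injective_algebraMap (FaithfulSMul.algebraMap_injective Qm E.FunctionField)

theorem uOf_UFun_ne_zero : uOf M UFun VFun ≠ 0 := by
  have := functionField_charZero
  refine div_ne_zero (mul_ne_zero (mul_ne_zero (mul_ne_zero (by norm_num) algebraMap_mm_ne_zero)
    algebraMap_mm_sub_one_ne_zero) fun h => ?_) psi_UFun_ne_zero
  have h0 := (UFun_VFun_independent (q := 0)
    (p := C ((mm + 1) ^ 2 * (mm - 1) ^ 2) * X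
      - C (420 * mm ^ 10 + 4812 * mm ^ 8 + 12648 * mm ^ 6 + 14232 * mm ^ 4 + 4404 * mm ^ 2 + 348))
    (by
      simp only [map_sub, map_mul, aeval_C, aeval_X, map_add, map_pow, map_one, map_ofNat,
        map_zero]
      linear_combination h)).1
  have h1 : ∀ a b : Qm, C a * X - C b = 0 → a = 0 := fun a b h => by
    have := congrArg (fun p => coeff p 1) h
    simpa [coeff_C] using this
  exact mul_ne_zero (pow_ne_zero 2 mm_add_one_ne_zero) (pow_ne_zero 2 mm_sub_one_ne_zero)
    (h1 _ _ h0)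

theorem phi_map (u : E.FunctionField) : phi M u = aeval u (phiPoly mm) := by
  simp only [phi, phiPoly, map_sum, map_mul, aeval_C, map_pow, aeval_X]
  refine Finset.sum_congr rfl fun i _ => ?_
  congr 1
  fin_cases i <;>
    simp [phiCoeff, map_ofNat]

section Subfield

variable {L : Type*} [Field L] (A : Subfield L) {m u v : L}

theorem phi_mem (hm : m ∈ A) (hu : u ∈ A) : phi m u ∈ A := by
  rw [phi_eq]
  repeat first
    | assumption | exact one_mem A | exact ofNat_mem A _ | apply div_mem | apply add_mem
    | apply sub_mem | apply mul_mem | apply pow_mem | apply neg_mem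

theorem UOf_mem (hm : m ∈ A) (hu : u ∈ A) (hv : v ∈ A) : UOf m u v ∈ A := by
  unfold UOf
  repeat first
    | assumption | exact one_mem A | exact ofNat_mem A _ | apply div_mem | apply add_mem
    | apply sub_mem | apply mul_mem | apply pow_mem | apply neg_mem

theorem VOf_mem (hm : m ∈ A) (hu : u ∈ A) (hv : v ∈ A) : VOf m u v ∈ A := by
  unfold VOf
  repeat first
    | assumption | exact one_mem A | exact ofNat_mem A _ | apply div_mem | apply add_mem
    | apply sub_mem | apply mul_mem | apply pow_mem | apply neg_mem

end Subfield

/-- The formulas for `u` and `v` satisfy the equation of the quartic, and are inverted by the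
formulas for `U` and `V`. -/
theorem function_field_formulas :
    vOf M UFun VFun ^ 2 = phi M (uOf M UFun VFun) ∧
      UOf M (uOf M UFun VFun) (vOf M UFun VFun) = UFun ∧
      VOf M (uOf M UFun VFun) (vOf M UFun VFun) = VFun := by
  have := functionField_charZero
  obtain ⟨h1, h2⟩ := cubic_to_quartic algebraMap_mm_ne_zero algebraMap_mm_sub_one_ne_zero
    algebraMap_mm_add_one_ne_zero two_ne_zero three_ne_zero VFun_sq psi_UFun_ne_zero
  exact ⟨h1, h2 uOf_UFun_ne_zero⟩

/-- If u were algebraic over ℚ(m), then so would be v, a square root of φ(u), and hence U, which is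
rational in u and v. -/
theorem uOf_UFun_transcendental : Transcendental Qm (uOf M UFun VFun) := by
  intro hu
  obtain ⟨h1, h2, -⟩ := function_field_formulas
  let A := algebraicClosure Qm E.FunctionField
  have hA : ∀ x, x ∈ A.toSubfield ↔ IsAlgebraic Qm x := fun x => mem_algebraicClosure_iff
  have hm : M ∈ A.toSubfield := (hA _).mpr (isAlgebraic_algebraMap _)
  have hu' : uOf M UFun VFun ∈ A.toSubfield := (hA _).mpr hu
  have hv : vOf M UFun VFun ∈ A.toSubfield :=
    (hA _).mpr (IsAlgebraic.of_pow two_pos ((hA _).mp (h1 ▸ phi_mem A.toSubfield hm hu')))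
  exact UFun_transcendental ((hA _).mp (h2 ▸ UOf_mem A.toSubfield hm hu' hv))

/-- The homomorphism of the coordinate ring of the quartic given by the formulas. -/
noncomputable def quarticHom : QuarticRing →ₐ[Qm] E.FunctionField :=
  AdjoinRoot.liftAlgHom _ (aeval (uOf M UFun VFun)) (vOf M UFun VFun) (by
    rw [eval₂_sub, eval₂_pow, eval₂_X, eval₂_C, function_field_formulas.1, phi_map]
    exact sub_self _)

/-- Modulo v² - φ every element is a + bv with a, b polynomials in u; if it maps to 0, so does its
norm a² - b²φ. -/
theorem quarticHom_injective : Function.Injective quarticHom := by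
  rw [injective_iff_map_eq_zero]
  intro x hx
  have hmonic : (X ^ 2 - C (phiPoly mm) : Qm[X][X]).Monic := monic_X_pow_sub_C _ two_ne_zero
  obtain ⟨g, rfl⟩ := AdjoinRoot.mk_surjective x
  have hg : AdjoinRoot.mk (X ^ 2 - C (phiPoly mm)) (g %ₘ (X ^ 2 - C (phiPoly mm)))
      = AdjoinRoot.mk (X ^ 2 - C (phiPoly mm)) g := by
    refine AdjoinRoot.mk_eq_mk.mpr ⟨-(g /ₘ (X ^ 2 - C (phiPoly mm))), ?_⟩
    linear_combination modByMonic_add_div g (X ^ 2 - C (phiPoly mm))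
  rw [← hg] at hx ⊢
  have hdeg : (g %ₘ (X ^ 2 - C (phiPoly mm))).natDegree ≤ 1 := by
    have := natDegree_modByMonic_lt g hmonic (fun h => by
      have := congrArg natDegree h
      rw [natDegree_X_pow_sub_C, natDegree_one] at this
      omega)
    rw [natDegree_X_pow_sub_C] at this
    omega
  obtain ⟨b, a, e⟩ := exists_eq_X_add_C_of_natDegree_le_one hdeg
  rw [e] at hx ⊢
  have h1 : aeval (uOf M UFun VFun) b * vOf M UFun VFun + aeval (uOf M UFun VFun) a = 0 := by
    simpa [quarticHom] using hx
  -- Multiplication by the conjugate a - bv. Transcendence of u then makes the norm zero as a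
  -- polynomial.
  have h2 : aeval (uOf M UFun VFun) (a ^ 2 - b ^ 2 * phiPoly mm) = 0 := by
    rw [map_sub, map_mul, map_pow, map_pow, ← phi_map, ← function_field_formulas.1]
    linear_combination (aeval (uOf M UFun VFun) a - aeval (uOf M UFun VFun) b * vOf M UFun VFun)
      * h1
  have h3 := (transcendental_iff.mp uOf_UFun_transcendental) _ h2
  have hb := eq_zero_of_sq_eq_sq_mul_phiPoly (sub_eq_zero.mp h3)
  rw [hb] at h3
  have ha : a = 0 := by simpa using h3
  rw [ha, hb]
  simp

theorem birationalByFormulas : BirationalByFormulas := by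
  -- The quartic ring is a domain because it embeds in a field; only then is its total fraction ring
  -- a field.
  have : IsDomain QuarticRing := quarticHom_injective.isDomain quarticHom.toRingHom
  let e : QuarticField →ₐ[Qm] E.FunctionField := IsFractionRing.liftAlgHom quarticHom_injective
  have heu : e uFun = uOf M UFun VFun := by
    simp only [e, uFun, IsFractionRing.liftAlgHom_apply]
    erw [IsFractionRing.lift_algebraMap]
    simp [quarticHom]
  have hev : e vFun = vOf M UFun VFun := by
    simp only [e, vFun, IsFractionRing.liftAlgHom_apply]
    erw [IsFractionRing.lift_algebraMap]
    simp [quarticHom]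
  obtain ⟨-, hU, hV⟩ := function_field_formulas
  -- The image is a subfield containing the constants, u and v, hence U and V by the inverse
  -- formulas, hence all quotients of elements of the coordinate ring.
  have hsurj : Function.Surjective e := by
    let A : Subfield E.FunctionField := e.toRingHom.fieldRange
    have hm : ∀ x : Qm, algebraMap Qm E.FunctionField x ∈ A :=
      fun x => ⟨algebraMap Qm QuarticField x, e.commutes x⟩
    have hu : uOf M UFun VFun ∈ A := ⟨uFun, heu⟩
    have hv : vOf M UFun VFun ∈ A := ⟨vFun, hev⟩
    have hUA : UFun ∈ A := hU ▸ UOf_mem A (hm mm) hu hv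
    have hVA : VFun ∈ A := hV ▸ VOf_mem A (hm mm) hu hv
    have hpA : ∀ p : Qm[X], aeval UFun p ∈ A := by
      intro p
      induction p using Polynomial.induction_on' with
      | add p q hp hq => rw [map_add]; exact add_mem hp hq
      | monomial n a => rw [aeval_monomial]; exact mul_mem (hm a) (pow_mem hUA n)
    have hcA : ∀ x : E.CoordinateRing, algebraMap E.CoordinateRing E.FunctionField x ∈ A := by
      intro x
      obtain ⟨p, q, rfl⟩ := WeierstrassCurve.Affine.CoordinateRing.exists_smul_basis_eq x
      rw [WeierstrassCurve.Affine.CoordinateRing.smul,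
        WeierstrassCurve.Affine.CoordinateRing.smul, mul_one, map_add, map_mul,
        ← aeval_UFun, ← aeval_UFun]
      exact add_mem (hpA p) (mul_mem (hpA q) hVA)
    intro z
    obtain ⟨x, y, -, rfl⟩ := IsFractionRing.div_surjective (A := E.CoordinateRing) z
    exact div_mem (hcA x) (hcA y)
  have hbij : Function.Bijective e := ⟨e.toRingHom.injective, hsurj⟩
  have heu' : AlgEquiv.ofBijective e hbij uFun = uOf M UFun VFun := heu
  have hev' : AlgEquiv.ofBijective e hbij vFun = vOf M UFun VFun := hev
  refine ⟨AlgEquiv.ofBijective e hbij, psi_UFun_ne_zero, heu', hev', ?_⟩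
  rw [heu', hev']
  exact ⟨uOf_UFun_ne_zero, hU.symm, hV.symm⟩

end FunctionFields

/-! ### The values of the roots at the place `m² = -3` -/

/-- The value of `u` behaves at the place `m² = -3` as for the `n`-th multiple of the point. -/
def ULeadsLike (n : ℂ) (u : Qm) : Prop := HasVal (u / (mm ^ 2 + 3)) (ρ * (ρ - 1) * n / 4)

theorem hasVal_three_mul_sq_add_one : HasVal (3 * mm ^ 2 + 1) (-8) :=
  (((HasVal.ofNat 3).mul (HasVal.X.pow 2)).add HasVal.one).congr rfl
    (by rw [rootNegThree_sq]; norm_num)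

theorem mm_denom_ne_zero : 3 * mm ^ 2 + 1 ≠ 0 := hasVal_three_mul_sq_add_one.ne_zero (by norm_num)

theorem hasVal_ratioK : HasVal ((mm ^ 2 - 1) / (3 * mm ^ 2 + 1)) (1 / 2) :=
  (((HasVal.X.pow 2).sub HasVal.one).div hasVal_three_mul_sq_add_one (by norm_num)).congr rfl
    (by rw [rootNegThree_sq]; norm_num)

namespace ULeadsLike

variable {n : ℂ} {u : Qm}

theorem ne_zero (hn : n ≠ 0) (h : ULeadsLike n u) : u ≠ 0 := by
  have := HasVal.ne_zero h (div_ne_zero (mul_ne_zero (mul_ne_zero rootNegThree_ne_zero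
    rootNegThree_sub_one_ne_zero) hn) (by norm_num))
  exact (div_ne_zero_iff.mp this).1

theorem hasVal (h : ULeadsLike n u) : HasVal u 0 := by
  refine (HasVal.mul h hasVal_uniformizer).congr ?_ (mul_zero _)
  rw [div_mul_cancel₀ _ mm_sq_add_three_ne_zero]

theorem hasVal_denom (h : ULeadsLike n u) :
    HasVal ((3 * mm ^ 2 + 1) * ((mm + 1) * u ^ 2 - mm + 1)) (8 * (ρ - 1)) :=
  (hasVal_three_mul_sq_add_one.mul (((((HasVal.X.add HasVal.one).mul (h.hasVal.pow 2)).sub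
    HasVal.X)).add HasVal.one)).congr rfl (by ring)

theorem denom_ne_zero (h : ULeadsLike n u) :
    (3 * mm ^ 2 + 1) * ((mm + 1) * u ^ 2 - mm + 1) ≠ 0 :=
  h.hasVal_denom.ne_zero (mul_ne_zero (by norm_num) rootNegThree_sub_one_ne_zero)

/-- Both factors u and (m+1)(m²+1)u - m(m²+3) of the numerator vanish to order at least 1 at the
place, which gives the square of the uniformizer. -/
theorem hasVal_ratioH_div (h : ULeadsLike n u) :
    HasVal (ratioH mm u / (mm ^ 2 + 3) ^ 2) (3 * n * (2 * n - 1) / 16) := by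
  have h3 := mm_sq_add_three_ne_zero
  have hρ := rootNegThree_sub_one_ne_zero
  refine ((((HasVal.ofNat 2).neg.mul h).mul ((((HasVal.X.add HasVal.one).mul
    ((HasVal.X.pow 2).add HasVal.one)).mul h).sub HasVal.X)).div h.hasVal_denom
    (mul_ne_zero (by norm_num) hρ)).congr ?_ ?_
  · have hδ := h.denom_ne_zero
    rw [ratioH]
    field_simp
  · rw [div_eq_div_iff (mul_ne_zero (by norm_num) hρ) (by norm_num)]
    linear_combination (ρ - 1) * n * (8 - 2 * n * (ρ ^ 4 - 3 * ρ ^ 2 + 8)) * rootNegThree_sq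

theorem ratioH_ne_zero (hn : n ≠ 0) (hn' : 2 * n - 1 ≠ 0) (h : ULeadsLike n u) :
    ratioH mm u ≠ 0 :=
  (div_ne_zero_iff.mp (h.hasVal_ratioH_div.ne_zero (div_ne_zero (mul_ne_zero (mul_ne_zero
    (by norm_num) hn) hn') (by norm_num)))).1

theorem hasVal_ratioH (h : ULeadsLike n u) : HasVal (ratioH mm u) 0 := by
  refine (h.hasVal_ratioH_div.mul (hasVal_uniformizer.pow 2)).congr ?_ (by ring)
  rw [div_mul_cancel₀ _ (pow_ne_zero _ mm_sq_add_three_ne_zero)]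

theorem hasVal_prodS (h : ULeadsLike n u) : HasVal (prodS mm (ratioH mm u)) (1 / 4) := by
  refine ((((HasVal.X.pow 2).sub HasVal.one).neg.mul (((h.hasVal_ratioH.pow 2).add
    ((HasVal.one.sub hasVal_ratioK).mul h.hasVal_ratioH)).add (hasVal_ratioK.pow 2))).div
    (HasVal.ofNat 4) (by norm_num)).congr rfl ?_
  rw [rootNegThree_sq]
  norm_num

/-- No value of v at the place is used: only the products of the pairs are evaluated, and both have
the value 1/4. -/
theorem rootY_ne_zero {v : Qm} (hn : n ≠ 0) (h : ULeadsLike n u) (hv : v ^ 2 = phi mm u) :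
    rootY mm u v 0 ≠ 0 ∧ rootY mm u v 2 ≠ 0 := by
  have h1 := rootY_prod_left (v := v) two_ne_zero mm_denom_ne_zero (h.ne_zero hn) h.denom_ne_zero
  have h2 := rootY_prod_right two_ne_zero mm_denom_ne_zero h.denom_ne_zero hv
  constructor
  · refine left_ne_zero_of_mul (b := rootY mm u v 1) ?_
    rw [h1]
    exact h.hasVal_prodS.ne_zero (by norm_num)
  · refine left_ne_zero_of_mul (b := rootY mm u v 3) ?_
    rw [h2]
    exact (h.hasVal_prodS.sub h.hasVal_ratioH).ne_zero (by norm_num)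

/-- Up to nonzero factors this is X₁⁵ + X₂⁵ - Y₁⁵ - Y₂⁵; at the place the sums are -1/2 and 1, both
products are 1/4, and the value is -3/32. -/
theorem left_side_ne_zero {v : Qm} (hn : n ≠ 0) (h : ULeadsLike n u) (hv : v ^ 2 = phi mm u) :
    (solX mm u v 0 ^ 5 + solX mm u v 1 ^ 5) * (solX mm u v 2 ^ 5 + solX mm u v 3 ^ 5) ≠ 0 := by
  have hu := h.ne_zero hn
  have hδ := h.denom_ne_zero
  obtain ⟨h0, h2⟩ := h.rootY_ne_zero hn hv
  have hp := rootX_prod_left (u := u) two_ne_zero mm_denom_ne_zero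
  have hp' := rootY_prod_left (v := v) two_ne_zero mm_denom_ne_zero hu hδ
  have e := left_side_sol (k := 5) (by decide) (X := rootX mm u) (Y := rootY mm u v)
    (hp.trans hp'.symm)
  simp only [solX, Matrix.cons_val]
  rw [e]
  refine mul_ne_zero (mul_ne_zero (pow_ne_zero _ h0) (pow_ne_zero _ h2)) ?_
  rw [sub_sub, add_pow_five, add_pow_five (rootY mm u v 0), hp, hp', rootX_sum_left two_ne_zero,
    rootY_sum_left two_ne_zero]
  have hs := h.hasVal_ratioH.sub hasVal_ratioK
  have hP := h.hasVal_prodS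
  refine ((((hs.pow 5).sub (((HasVal.ofNat 5).mul (hs.pow 3)).mul hP)).add
    (((HasVal.ofNat 5).mul hs).mul (hP.pow 2))).sub
    (((HasVal.one.pow 5).sub (((HasVal.ofNat 5).mul (HasVal.one.pow 3)).mul hP)).add
    (((HasVal.ofNat 5).mul HasVal.one).mul (hP.pow 2)))).ne_zero ?_
  norm_num

theorem powerEq_five {v : Qm} (hn : n ≠ 0) (h : ULeadsLike n u) (hv : v ^ 2 = phi mm u) :
    PowerEq 5 (solX mm u v) (solY mm u v) := by
  have hu := h.ne_zero hn
  have hδ := h.denom_ne_zero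
  obtain ⟨h0, h2⟩ := h.rootY_ne_zero hn hv
  exact (powerEq_sol_iff (by decide) h0 h2
    ((rootX_prod_left two_ne_zero mm_denom_ne_zero).trans
      (rootY_prod_left two_ne_zero mm_denom_ne_zero hu hδ).symm)
    ((rootX_prod_right two_ne_zero mm_denom_ne_zero).trans
      (rootY_prod_right two_ne_zero mm_denom_ne_zero hδ hv).symm)).mpr
    (roots_pow_five two_ne_zero mm_denom_ne_zero hu hδ hv)

/-- The defect of the cubes is 3kh(1+k-h), where k has the value 1/2, h is nonzero, and 1+k-h has
the value 3/2. -/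
theorem not_powerEq_three {v : Qm} (hn : n ≠ 0) (hn' : 2 * n - 1 ≠ 0) (h : ULeadsLike n u)
    (hv : v ^ 2 = phi mm u) : ¬ PowerEq 3 (solX mm u v) (solY mm u v) := by
  have hu := h.ne_zero hn
  have hδ := h.denom_ne_zero
  obtain ⟨h0, h2⟩ := h.rootY_ne_zero hn hv
  intro hpow
  have e := (powerEq_sol_iff (by decide) h0 h2
    ((rootX_prod_left two_ne_zero mm_denom_ne_zero).trans
      (rootY_prod_left two_ne_zero mm_denom_ne_zero hu hδ).symm)
    ((rootX_prod_right two_ne_zero mm_denom_ne_zero).trans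
      (rootY_prod_right two_ne_zero mm_denom_ne_zero hδ hv).symm)).mp hpow
  have e' := roots_pow_three two_ne_zero mm_denom_ne_zero hu hδ hv
  rw [sub_eq_zero.mpr e] at e'
  refine mul_ne_zero (mul_ne_zero (mul_ne_zero three_ne_zero
    (hasVal_ratioK.ne_zero (by norm_num))) (h.ratioH_ne_zero hn hn')) ?_ e'.symm
  exact ((HasVal.one.add hasVal_ratioK).sub h.hasVal_ratioH).ne_zero (by norm_num)

end ULeadsLike

/-- The ratio `s₁ / S₁`, which is invariant under scaling, determines `h / S₁²`. -/
theorem ObtainedFrom.ratio {u : Qm} {x y : Fin 4 → Qm} (h : ObtainedFrom mm u x y) :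
    -(x 0 * x 3) + -(x 1 * x 2) ≠ 0 ∧ x 0 * x 2 + x 1 * x 3
      = (ratioH mm u - (mm ^ 2 - 1) / (3 * mm ^ 2 + 1)) * (-(x 0 * x 3) + -(x 1 * x 2)) := by
  obtain ⟨S, h, s, t, T, s', t', hS, -, rfl, -, hs, -, -, -, -, h1, -, -, -, h2, -⟩ := h
  rw [h1, h2]
  refine ⟨hS, ?_⟩
  have h3 := mm_denom_ne_zero
  rw [hs, hOf_eq, div_eq_iff (mul_ne_zero h3 hS)]
  have : (mm ^ 2 - 1) / (3 * mm ^ 2 + 1) * (3 * mm ^ 2 + 1) = mm ^ 2 - 1 := div_mul_cancel₀ _ h3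
  linear_combination S ^ 2 * this

theorem ratioH_eq_of_scalingEquiv {u u' : Qm} {x y x' y' : Fin 4 → Qm}
    (h : ObtainedFrom mm u x y) (h' : ObtainedFrom mm u' x' y') (hs : ScalingEquiv x y x' y') :
    ratioH mm u = ratioH mm u' := by
  obtain ⟨a, b, c, d, ha, hb, -, -, e0, e1, e2, e3, -⟩ := hs
  obtain ⟨h1, h2⟩ := h.ratio
  obtain ⟨-, h2'⟩ := h'.ratio
  rw [e0, e1, e2, e3] at h2'
  have : a * b * (-(x 0 * x 3) + -(x 1 * x 2)) ≠ 0 := mul_ne_zero (mul_ne_zero ha hb) h1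
  apply mul_right_cancel₀ this
  linear_combination h2' - a * b * h2

/-! ### The coordinates of the multiples are computable -/

/-- Abscissa and ordinate are kept over one common denominator, so that the chord law becomes a
polynomial map on triples in ℤ[m]. -/
theorem RatPrimrec.of_chord_recursion {x₀ y₀ : Qm} {x y : ℕ → Qm} (hne : ∀ n, x n ≠ x₀)
    (hx : ∀ n, x (n + 1) = ((y n - y₀) / (x n - x₀)) ^ 2 - x n - x₀)
    (hy : ∀ n, y (n + 1) = (y n - y₀) / (x n - x₀) * (x n - x (n + 1)) - y n) :
    RatPrimrec x ∧ RatPrimrec y := by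
  have key : ∀ a b : Qm, ∃ p q r : ℤ[X], r ≠ 0 ∧ a = polyToQm p / polyToQm r ∧
      b = polyToQm q / polyToQm r := by
    intro a b
    obtain ⟨p, r, hr, rfl⟩ := exists_polyToQm_div a
    obtain ⟨p', r', hr', rfl⟩ := exists_polyToQm_div b
    have h1 := polyToQm_ne_zero hr
    have h2 := polyToQm_ne_zero hr'
    refine ⟨p * r', p' * r, r * r', mul_ne_zero hr hr', ?_, ?_⟩ <;>
    · simp only [map_mul]; field_simp
  obtain ⟨N₀, M₀, W₀, hW₀, eN₀, eM₀⟩ := key x₀ y₀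
  obtain ⟨N₁, M₁, W₁, hW₁, eN₁, eM₁⟩ := key (x 0) (y 0)
  -- The slope is p/q, the new abscissa is r/(q²WW₀), and the new common denominator is q³WW₀; no
  -- cancellation is attempted.
  let q : ℤ[X] → ℤ[X] → ℤ[X] → ℤ[X] := fun N _ W => N * W₀ - N₀ * W
  let p : ℤ[X] → ℤ[X] → ℤ[X] → ℤ[X] := fun _ M W => M * W₀ - M₀ * W
  let r : ℤ[X] → ℤ[X] → ℤ[X] → ℤ[X] := fun N M W =>
    p N M W ^ 2 * (W * W₀) - q N M W ^ 2 * (N * W₀ + N₀ * W)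
  let f : ℤ[X] → ℤ[X] → ℤ[X] → ℤ[X] := fun N M W => q N M W * r N M W
  let g : ℤ[X] → ℤ[X] → ℤ[X] → ℤ[X] := fun N M W =>
    p N M W * (N * (q N M W ^ 2 * W₀) - r N M W) - M * (q N M W ^ 3 * W₀)
  let k : ℤ[X] → ℤ[X] → ℤ[X] → ℤ[X] := fun N M W => q N M W ^ 3 * (W * W₀)
  let S : ℕ → ℤ[X] × ℤ[X] × ℤ[X] := fun n => Nat.rec (N₁, M₁, W₁)
    (fun _ s => (f s.1 s.2.1 s.2.2, g s.1 s.2.1 s.2.2, k s.1 s.2.1 s.2.2)) n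
  have hN : PolyPrimrec fun s : List ℤ × List ℤ × List ℤ => toPoly s.1 := .toPoly_of Primrec.fst
  have hM : PolyPrimrec fun s : List ℤ × List ℤ × List ℤ => toPoly s.2.1 :=
    .toPoly_of (Primrec.fst.comp Primrec.snd)
  have hW : PolyPrimrec fun s : List ℤ × List ℤ × List ℤ => toPoly s.2.2 :=
    .toPoly_of (Primrec.snd.comp Primrec.snd)
  have c₀ : PolyPrimrec fun _ : List ℤ × List ℤ × List ℤ => W₀ := .const _
  have c₁ : PolyPrimrec fun _ : List ℤ × List ℤ × List ℤ => N₀ := .const _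
  have c₂ : PolyPrimrec fun _ : List ℤ × List ℤ × List ℤ => M₀ := .const _
  have hq := (hN.mul c₀).sub (c₁.mul hW)
  have hp := (hM.mul c₀).sub (c₂.mul hW)
  have hr := ((hp.pow 2).mul (hW.mul c₀)).sub ((hq.pow 2).mul ((hN.mul c₀).add (c₁.mul hW)))
  obtain ⟨h1, h2, h3⟩ := PolyPrimrec.rec (a := fun n => (S n).1) (b := fun n => (S n).2.1)
    (c := fun n => (S n).2.2) f g k (hq.mul hr)
    ((hp.mul ((hN.mul ((hq.pow 2).mul c₀)).sub hr)).sub (hM.mul ((hq.pow 3).mul c₀)))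
    ((hq.pow 3).mul (hW.mul c₀)) (fun _ => rfl) (fun _ => rfl) (fun _ => rfl)
  have inv : ∀ n, (S n).2.2 ≠ 0 ∧ x n = polyToQm (S n).1 / polyToQm (S n).2.2 ∧
      y n = polyToQm (S n).2.1 / polyToQm (S n).2.2 := by
    intro n
    induction n with
    | zero => exact ⟨hW₁, eN₁, eM₁⟩
    | succ n ih =>
      obtain ⟨i1, i2, i3⟩ := ih
      have e1 : (S (n + 1)).1 = f (S n).1 (S n).2.1 (S n).2.2 := rfl
      have e2 : (S (n + 1)).2.1 = g (S n).1 (S n).2.1 (S n).2.2 := rfl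
      have e3 : (S (n + 1)).2.2 = k (S n).1 (S n).2.1 (S n).2.2 := rfl
      rw [hy, hx, e1, e2, e3]
      have hxn := hne n
      rw [eN₀] at hxn ⊢
      rw [i2] at hxn ⊢
      rw [eM₀, i3]
      generalize (S n).1 = N at *
      generalize (S n).2.1 = M at *
      generalize (S n).2.2 = W at *
      have w0 := polyToQm_ne_zero hW₀
      have w := polyToQm_ne_zero i1
      have hq0 : polyToQm N * polyToQm W₀ - polyToQm N₀ * polyToQm W ≠ 0 := by
        intro h
        apply hxn
        rw [div_eq_div_iff w w0]
        linear_combination h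
      have hq1 : q N M W ≠ 0 := by
        intro h
        apply hq0
        have := congrArg polyToQm h
        simpa [q] using this
      refine ⟨mul_ne_zero (pow_ne_zero _ hq1) (mul_ne_zero i1 hW₀), ?_, ?_⟩
      · simp only [f, k, r, p, q, map_mul, map_sub, map_pow, map_add]
        rw [div_sub_div _ _ w w0, div_sub_div _ _ w w0]
        generalize polyToQm N = N' at *
        generalize polyToQm M = M' at *
        generalize polyToQm W = W' at *
        generalize polyToQm N₀ = N₀' at *
        generalize polyToQm M₀ = M₀' at *
        generalize polyToQm W₀ = W₀' at *
        obtain ⟨Q, hQ⟩ : ∃ Q, Q = N' * W₀' - N₀' * W' := ⟨_, rfl⟩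
        rw [show N' * W₀' - W' * N₀' = Q by rw [hQ]; ring, ← hQ]
        rw [← hQ] at hq0
        field_simp
        ring
      · simp only [g, k, r, p, q, map_mul, map_sub, map_pow, map_add]
        rw [div_sub_div _ _ w w0, div_sub_div _ _ w w0]
        generalize polyToQm N = N' at *
        generalize polyToQm M = M' at *
        generalize polyToQm W = W' at *
        generalize polyToQm N₀ = N₀' at *
        generalize polyToQm M₀ = M₀' at *
        generalize polyToQm W₀ = W₀' at *
        obtain ⟨Q, hQ⟩ : ∃ Q, Q = N' * W₀' - N₀' * W' := ⟨_, rfl⟩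
        rw [show N' * W₀' - W' * N₀' = Q by rw [hQ]; ring, ← hQ]
        rw [← hQ] at hq0
        field_simp
        ring
  exact ⟨⟨_, _, h1, h3, fun n => (inv n).1, fun n => (inv n).2.1⟩,
    ⟨_, _, h2, h3, fun n => (inv n).1, fun n => (inv n).2.2⟩⟩

/-! ### The point and its multiples -/

theorem u₀_denom_ne_zero : 2 * mm ^ 14 - 41 * mm ^ 12 - 328 * mm ^ 10 - 967 * mm ^ 8
    - 1382 * mm ^ 6 - 1047 * mm ^ 4 - 308 * mm ^ 2 - 25 ≠ 0 := by
  have h : HasVal (2 * mm ^ 14 - 41 * mm ^ 12 - 328 * mm ^ 10 - 967 * mm ^ 8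
    - 1382 * mm ^ 6 - 1047 * mm ^ 4 - 308 * mm ^ 2 - 25) (2 * ρ ^ 14 - 41 * ρ ^ 12
    - 328 * ρ ^ 10 - 967 * ρ ^ 8 - 1382 * ρ ^ 6 - 1047 * ρ ^ 4 - 308 * ρ ^ 2 - 25) := by
    repeat first
      | exact HasVal.X | exact HasVal.one | exact HasVal.ofNat _ | apply HasVal.add
      | apply HasVal.sub | apply HasVal.mul | apply HasVal.pow | apply HasVal.neg
  refine h.ne_zero ?_
  rw [rootNegThree_pow_even 1, rootNegThree_pow_even 2, rootNegThree_pow_even 3,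
    rootNegThree_pow_even 4, rootNegThree_pow_even 5, rootNegThree_pow_even 6,
    rootNegThree_pow_even 7]
  norm_num

/-- The equation u = u₀ at P' with denominators cleared and common factors removed, which makes it a
polynomial identity. -/
theorem u₀_identity {L : Type*} [Field L] (m : L) :
    6 * ((m + 1) ^ 2 * (m - 1) ^ 2 * numU₀ m - (420 * m ^ 10 + 4812 * m ^ 8
      + 12648 * m ^ 6 + 14232 * m ^ 4 + 4404 * m ^ 2 + 348) * den m ^ 2)
      * (2 * m ^ 14 - 41 * m ^ 12 - 328 * m ^ 10 - 967 * m ^ 8 - 1382 * m ^ 6 - 1047 * m ^ 4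
        - 308 * m ^ 2 - 25)
      = (m + 1) * (m - 1) * (6 * (m ^ 2 + 3) * (m ^ 4 + 6 * m ^ 2 + 1) * numU₀ m * den m
        + (m ^ 2 - 1) * numV₀ m - 72 * (m ^ 2 - 1) * (m ^ 2 + 3)
          * (35 * m ^ 8 + 86 * m ^ 6 + 108 * m ^ 4 + 26 * m ^ 2 + 1) * den m ^ 3) := by
  simp only [numU₀, numV₀, den]
  ring

theorem psi_point_ne_zero : psi mm (U₀ mm) (V₀ mm) ≠ 0 :=
  (leadsLike_one.psi_ne_zero one_ne_zero).1

theorem uOf_point : uOf mm (U₀ mm) (V₀ mm) = u₀ mm := by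
  have hd := den_ne_zero
  have hU : U₀ mm * den mm ^ 2 = numU₀ mm := div_mul_cancel₀ _ (pow_ne_zero _ hd)
  have hV : V₀ mm * den mm ^ 3 = numV₀ mm := div_mul_cancel₀ _ (pow_ne_zero _ hd)
  have h := u₀_identity mm
  rw [← hU, ← hV] at h
  rw [uOf, u₀, div_eq_div_iff psi_point_ne_zero u₀_denom_ne_zero]
  apply mul_left_cancel₀ (pow_ne_zero 2 hd)
  rw [show mm * (mm + 1) ^ 2 * (mm - 1) ^ 3 * (mm ^ 2 + 3)
    * (7 * mm ^ 6 + 23 * mm ^ 4 + 29 * mm ^ 2 + 5) = mm * (mm + 1) * (mm - 1) ^ 2 * den mm by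
      rw [den]; ring, psi]
  linear_combination mm * (mm - 1) * h

theorem u₀_ne_zero : u₀ mm ≠ 0 := by
  rw [← uOf_point]
  exact ULeadsLike.ne_zero one_ne_zero (leadsLike_one.psi_ne_zero one_ne_zero).2

theorem nonsingular_point : E.Nonsingular (U₀ mm) (V₀ mm) :=
  (WeierstrassCurve.Affine.equation_iff_nonsingular_of_Δ_ne_zero (W := E) cubic_Δ_ne_zero).mp
    ((cubic_equation_iff _ _ _).mpr equation_point)

theorem vOf_sq_of_leadsLike {n : ℂ} {U V : Qm} (hn : n ≠ 0) (hl : LeadsLike n U V)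
    (h : E.Nonsingular U V) : vOf mm U V ^ 2 = phi mm (uOf mm U V) :=
  (cubic_to_quartic mm_ne_zero mm_sub_one_ne_zero mm_add_one_ne_zero two_ne_zero three_ne_zero
    ((cubic_equation_iff _ _ _).mp h.1) (hl.psi_ne_zero hn).1).1

theorem ULeadsLike.index_unique {n k : ℤ} {u : Qm} (hn : ULeadsLike n u) (hk : ULeadsLike k u) :
    n = k := by
  have h := HasVal.unique hn hk
  have h1 := mul_ne_zero rootNegThree_ne_zero rootNegThree_sub_one_ne_zero
  have : (n : ℂ) = k := by
    apply mul_left_cancel₀ h1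
    linear_combination 4 * h
  exact_mod_cast this

/-- Equality of the values at n+1 and k+1 gives (n-k)(2n+2k+3) = 0, whose second factor is positive.
-/
theorem ratioH_injective {n k : ℕ} {u u' : Qm} (hn : ULeadsLike (n + 1) u)
    (hk : ULeadsLike (k + 1) u') (h : ratioH mm u = ratioH mm u') : n = k := by
  have h1 := hn.hasVal_ratioH_div
  rw [h] at h1
  have h2 := h1.unique hk.hasVal_ratioH_div
  have h3 : ((n : ℂ) - k) * (2 * n + 2 * k + 3) = 0 := by linear_combination 16 / 3 * h2
  rcases mul_eq_zero.mp h3 with h4 | h4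
  · exact_mod_cast sub_eq_zero.mp h4
  · exact absurd h4 (by exact_mod_cast (by omega : 2 * n + 2 * k + 3 ≠ 0))

/-! ### The computable sequence of solutions -/

theorem polyToQm_powerEq {k : ℕ} {x y : Fin 4 → ℤ[X]} :
    PowerEq k (fun i => polyToQm (x i)) (fun i => polyToQm (y i)) ↔ PowerEq k x y := by
  unfold PowerEq
  rw [← polyToQm_injective.eq_iff]
  simp only [map_mul, map_add, map_pow]

theorem solution_nontrivial {n : ℂ} {u v : Qm} (hn : n ≠ 0) (hn' : 2 * n - 1 ≠ 0)
    (h : ULeadsLike n u) (hv : v ^ 2 = phi mm u) {c : Qm} (hc : c ≠ 0) {x y : Fin 4 → ℤ[X]}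
    (hx : ∀ i, polyToQm (x i) = c * solX mm u v i)
    (hy : ∀ i, polyToQm (y i) = c * solY mm u v i) :
    PowerEq 5 x y ∧ ¬ IsTrivialSol x y := by
  have key : ∀ k, PowerEq k x y ↔ PowerEq k (solX mm u v) (solY mm u v) := fun k => by
    rw [← polyToQm_powerEq, funext hx, funext hy, powerEq_smul_iff hc]
  refine ⟨(key 5).mpr (h.powerEq_five hn hv), ?_⟩
  rintro (h1 | ⟨h1, -⟩)
  · exact h.not_powerEq_three hn hn' hv ((key 3).mp (h1 3 (by decide)))
  · have e := congrArg polyToQm h1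
    simp only [map_mul, map_add, map_pow, map_zero, hx] at e
    -- Both factors of the left side have degree 5, so clearing denominators multiplies it by c¹⁰.
    refine mul_ne_zero (pow_ne_zero 10 hc) (h.left_side_ne_zero hn hv) ?_
    linear_combination e

section Sequence

variable {U V : ℕ → Qm} {h : ∀ n, E.Nonsingular (U n) (V n)}
  (hP : E.Nonsingular (U₀ mm) (V₀ mm))

/-- Index n stands for (n+1)P'. The chord recursion starts at 2P', since P' + P' is a tangent step;
the coordinates of P' are prepended afterwards. -/
theorem ratPrimrec_multiples
    (hs : ∀ n : ℕ, (n + 1) • (WeierstrassCurve.Affine.Point.some (U₀ mm) (V₀ mm) hP : E.Point)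
      = .some (U n) (V n) (h n))
    (hl : ∀ n : ℕ, LeadsLike (n + 1) (U n) (V n)) : RatPrimrec U ∧ RatPrimrec V := by
  have hne : ∀ n, U (n + 1) ≠ U₀ mm := fun n => by
    refine (LeadsLike.slope (n := (n + 1 : ℕ) + 1) ?_ ?_ ?_ (hl (n + 1))).1
    · exact Nat.cast_add_one_ne_zero (n + 1)
    · simpa using! (Nat.cast_add_one_ne_zero n : (n : ℂ) + 1 ≠ 0)
    · exact_mod_cast Nat.succ_ne_zero (n + 1 + 1)
  have step : ∀ n, U (n + 2) = ((V (n + 1) - V₀ mm) / (U (n + 1) - U₀ mm)) ^ 2 - U (n + 1) - U₀ mm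
      ∧ V (n + 2) = (V (n + 1) - V₀ mm) / (U (n + 1) - U₀ mm) * (U (n + 1) - U (n + 2))
        - V (n + 1) := by
    intro n
    obtain ⟨x, y, hxy, e, hx, hy⟩ := E_add_of_X_ne (h₁ := h (n + 1)) (h₂ := hP) (hne n)
    rw [← hs (n + 1), ← succ_nsmul, hs (n + 2)] at e
    obtain ⟨rfl, rfl⟩ := WeierstrassCurve.Affine.Point.some.inj e
    exact ⟨hx, hy⟩
  obtain ⟨h1, h2⟩ := RatPrimrec.of_chord_recursion (x := fun n => U (n + 1))
    (y := fun n => V (n + 1)) hne (fun n => (step n).1) (fun n => (step n).2)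
  constructor
  · have := h1.cons (U 0)
    refine (congrArg RatPrimrec (funext fun n => ?_)).mp this
    cases n <;> rfl
  · have := h2.cons (V 0)
    refine (congrArg RatPrimrec (funext fun n => ?_)).mp this
    cases n <;> rfl

end Sequence

theorem ratPrimrec_uOf_vOf {U V : ℕ → Qm} (hU : RatPrimrec U) (hV : RatPrimrec V)
    (h0 : ∀ n, psi mm (U n) (V n) ≠ 0) : RatPrimrec (fun n => uOf mm (U n) (V n)) ∧
      RatPrimrec (fun n => vOf mm (U n) (V n)) := by
  have hpsi : RatPrimrec fun n => psi mm (U n) (V n) :=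
    (((RatPrimrec.const _).mul hU).add ((RatPrimrec.const _).mul hV)).sub (RatPrimrec.const _)
  constructor
  · refine RatPrimrec.div ?_ hpsi h0
    exact (RatPrimrec.const _).mul (((((((((RatPrimrec.const _).mul hU).sub (RatPrimrec.const _)).sub
      (RatPrimrec.const _)).sub (RatPrimrec.const _)).sub (RatPrimrec.const _)).sub
      (RatPrimrec.const _)).sub (RatPrimrec.const _)))
  · refine RatPrimrec.div ?_ (hpsi.pow 2) fun n => pow_ne_zero _ (h0 n)
    exact (RatPrimrec.const _).mul ((((((RatPrimrec.const _).mul (hU.pow 3)).sub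
      ((RatPrimrec.const _).mul (hU.pow 2))).sub ((RatPrimrec.const _).mul (hV.pow 2))).sub
      ((RatPrimrec.const _).mul hV)).add (RatPrimrec.const _))

theorem ratPrimrec_sol {u v : ℕ → Qm} (hu : RatPrimrec u) (hv : RatPrimrec v)
    (hu0 : ∀ n, u n ≠ 0)
    (hδ : ∀ n, (3 * mm ^ 2 + 1) * ((mm + 1) * u n ^ 2 - mm + 1) ≠ 0) (i : Fin 4) :
    RatPrimrec (fun n => solX mm (u n) (v n) i) ∧ RatPrimrec (fun n => solY mm (u n) (v n) i) := by
  have c : ∀ x : Qm, RatPrimrec fun _ => x := RatPrimrec.const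
  have hd : RatPrimrec fun n => (3 * mm ^ 2 + 1) * ((mm + 1) * u n ^ 2 - mm + 1) :=
    (c _).mul ((((c _).mul (hu.pow 2)).sub (c _)).add (c _))
  have hh : RatPrimrec fun n => ratioH mm (u n) :=
    RatPrimrec.div (((c _).mul hu).mul (((c _).mul hu).sub (c _))) hd hδ
  have x0 : RatPrimrec fun n => rootX mm (u n) 0 :=
    ((hh.sub (c _)).add ((c _).mul (hh.add (c _)))).div (c 2) fun _ => two_ne_zero
  have x1 : RatPrimrec fun n => rootX mm (u n) 1 :=
    ((hh.sub (c _)).sub ((c _).mul (hh.add (c _)))).div (c 2) fun _ => two_ne_zero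
  have x2 : RatPrimrec fun n => rootX mm (u n) 2 :=
    (((c _).sub hh).add (((c _).mul hh).add (c _))).div (c 2) fun _ => two_ne_zero
  have x3 : RatPrimrec fun n => rootX mm (u n) 3 :=
    (((c _).sub hh).sub (((c _).mul hh).add (c _))).div (c 2) fun _ => two_ne_zero
  have y0 : RatPrimrec fun n => rootY mm (u n) (v n) 0 :=
    ((c _).add ((c _).add (((c _).mul hh).div hu hu0))).div (c 2) fun _ => two_ne_zero
  have y2 : RatPrimrec fun n => rootY mm (u n) (v n) 2 :=
    ((c _).add (hv.div hd hδ)).div (c 2) fun _ => two_ne_zero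
  fin_cases i
  · exact ⟨y0.mul y2, y2.mul y0⟩
  · exact ⟨(x1.mul y2).neg, (x3.mul y0).neg⟩
  · exact ⟨x0, x2.neg⟩
  · exact ⟨y0.neg, y2⟩

theorem exists_computable_scaling {x y : Fin 4 → ℕ → Qm} (hx : ∀ i, RatPrimrec (x i))
    (hy : ∀ i, RatPrimrec (y i)) :
    ∃ (s : ℕ → (Fin 4 → List ℤ) × (Fin 4 → List ℤ)) (c : ℕ → Qm), Computable s ∧
      (∀ n, c n ≠ 0) ∧ (∀ n i, polyToQm (toPoly ((s n).1 i)) = c n * x i n) ∧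
      ∀ n i, polyToQm (toPoly ((s n).2 i)) = c n * y i n := by
  obtain ⟨d, p, hd, hp, e⟩ := RatPrimrec.exists_common_denominator
    (F := Sum.elim x y) (by rintro (i | i); exacts [hx i, hy i])
  choose f hf hf' using hp
  refine ⟨fun n => (fun i => f (.inl i) n, fun i => f (.inr i) n), fun n => polyToQm (d n),
    Primrec.to_comp (Primrec.pair ?_ ?_), fun n => polyToQm_ne_zero (hd n), fun n i => ?_,
    fun n i => ?_⟩
  · exact Primrec.fin_curry.mpr (Primrec₂.swap (Primrec.fin_curry₁.mpr fun i => hf (.inl i)))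
  · exact Primrec.fin_curry.mpr (Primrec₂.swap (Primrec.fin_curry₁.mpr fun i => hf (.inr i)))
  · rw [hf']; exact e (.inl i) n
  · rw [hf']; exact e (.inr i) n

end FifthPowers

/-! ### Assembly of the theorem -/

open FifthPowers in
theorem mainTheorem3 :
    (cubic mm).IsElliptic ∧
    BirationalByFormulas ∧
    ∃ hP : E.Nonsingular (U₀ mm) (V₀ mm),
      -- the point `P'` of the cubic comes from the point with abscissa `u₀` on the quartic
      (psi mm (U₀ mm) (V₀ mm) ≠ 0 ∧ u₀ mm ≠ 0 ∧
        ∃ v₀ : Qm, v₀ ^ 2 = phi mm (u₀ mm) ∧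
          UOf mm (u₀ mm) v₀ = U₀ mm ∧ VOf mm (u₀ mm) v₀ = V₀ mm ∧
          uOf mm (U₀ mm) (V₀ mm) = u₀ mm ∧ vOf mm (U₀ mm) (V₀ mm) = v₀) ∧
      -- `P'` has infinite order
      addOrderOf (WeierstrassCurve.Affine.Point.some (U₀ mm) (V₀ mm) hP : E.Point) = 0 ∧
      -- the nonzero multiples of `P'` give infinitely many `u` for which `φ(u)` is a square
      (∀ n : ℤ, n ≠ 0 → ∃ (U V : Qm) (h : E.Nonsingular U V),
        n • (WeierstrassCurve.Affine.Point.some (U₀ mm) (V₀ mm) hP : E.Point) = .some U V h ∧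
        psi mm U V ≠ 0 ∧ vOf mm U V ^ 2 = phi mm (uOf mm U V)) ∧
      {u : Qm | ∃ (n : ℤ) (U V : Qm) (h : E.Nonsingular U V), n ≠ 0 ∧
        n • (WeierstrassCurve.Affine.Point.some (U₀ mm) (V₀ mm) hP : E.Point) = .some U V h ∧
        u = uOf mm U V}.Infinite ∧
      -- they give a computable sequence of nontrivial parametric solutions in `ℤ[m]`,
      -- no two of which differ by scaling only
      ∃ s : ℕ → (Fin 4 → List ℤ) × (Fin 4 → List ℤ), Computable s ∧
        (∀ n : ℕ,
          PowerEq 5 (fun i => toPoly ((s n).1 i)) (fun i => toPoly ((s n).2 i)) ∧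
          ¬ IsTrivialSol (fun i => toPoly ((s n).1 i)) (fun i => toPoly ((s n).2 i)) ∧
          ∃ (U V : Qm) (h : E.Nonsingular U V),
            (n + 1) • (WeierstrassCurve.Affine.Point.some (U₀ mm) (V₀ mm) hP : E.Point)
              = .some U V h ∧
            ObtainedFrom mm (uOf mm U V)
              (fun i => toQm ((s n).1 i)) (fun i => toQm ((s n).2 i))) ∧
        ∀ n k : ℕ, n ≠ k →
          ¬ ScalingEquiv (fun i => toQm ((s n).1 i)) (fun i => toQm ((s n).2 i))
            (fun i => toQm ((s k).1 i)) (fun i => toQm ((s k).2 i)) := by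
  have hP := nonsingular_point
  refine ⟨cubic_isElliptic, birationalByFormulas, hP, ?_, ?_, ?_, ?_, ?_⟩
  · obtain ⟨h1, h2⟩ := cubic_to_quartic mm_ne_zero mm_sub_one_ne_zero mm_add_one_ne_zero
      two_ne_zero three_ne_zero equation_point psi_point_ne_zero
    rw [uOf_point] at h1 h2
    obtain ⟨h3, h4⟩ := h2 u₀_ne_zero
    exact ⟨psi_point_ne_zero, u₀_ne_zero, _, h1, h3, h4, uOf_point, rfl⟩
  · rw [addOrderOf_eq_zero_iff']
    intro n hn h0
    obtain ⟨k, rfl⟩ := Nat.exists_eq_succ_of_ne_zero hn.ne'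
    obtain ⟨U, V, h, e, -⟩ := exists_nsmul hP k
    exact WeierstrassCurve.Affine.Point.some_ne_zero h (e.symm.trans h0)
  · intro n hn
    obtain ⟨U, V, h, e, hl⟩ := exists_zsmul hP hn
    have hn' : (n : ℂ) ≠ 0 := Int.cast_ne_zero.mpr hn
    exact ⟨U, V, h, e, (hl.psi_ne_zero hn').1, vOf_sq_of_leadsLike hn' hl h⟩
  · choose U V h e hl using fun n : ℕ => exists_zsmul hP (n := n + 1) (by omega)
    refine Set.infinite_of_injective_forall_mem (f := fun n => uOf mm (U n) (V n)) ?_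
      fun n => ⟨n + 1, U n, V n, h n, by omega, e n, rfl⟩
    have hu : ∀ n : ℕ, ULeadsLike ((n + 1 : ℤ) : ℂ) (uOf mm (U n) (V n)) := fun n =>
      ((hl n).psi_ne_zero (Int.cast_ne_zero.mpr (by omega))).2
    intro n k hnk
    have h1 := hu n
    simp only at hnk
    rw [hnk] at h1
    have := ULeadsLike.index_unique h1 (hu k)
    omega
  · choose U V h e hl using exists_nsmul hP
    have hn : ∀ n : ℕ, (n : ℂ) + 1 ≠ 0 := Nat.cast_add_one_ne_zero
    -- The value of h/t² at nP' has the factor 2n-1, an odd integer, so h never vanishes.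
    have hn' : ∀ n : ℕ, 2 * ((n : ℂ) + 1) - 1 ≠ 0 := fun n => by
      rw [show 2 * ((n : ℂ) + 1) - 1 = ((2 * n + 1 : ℕ) : ℂ) by push_cast; ring]
      exact Nat.cast_ne_zero.mpr (by omega)
    have hu : ∀ n : ℕ, ULeadsLike (n + 1) (uOf mm (U n) (V n)) := fun n =>
      ((hl n).psi_ne_zero (hn n)).2
    have hv := fun n => vOf_sq_of_leadsLike (hn n) (hl n) (h n)
    obtain ⟨cU, cV⟩ := ratPrimrec_multiples hP e hl
    obtain ⟨cu, cv⟩ := ratPrimrec_uOf_vOf cU cV fun n => ((hl n).psi_ne_zero (hn n)).1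
    have cs := ratPrimrec_sol cu cv (fun n => (hu n).ne_zero (hn n)) fun n => (hu n).denom_ne_zero
    obtain ⟨s, c, hs, hc, hx, hy⟩ := exists_computable_scaling (fun i => (cs i).1)
      fun i => (cs i).2
    have hob : ∀ n, ObtainedFrom mm (uOf mm (U n) (V n))
        (fun i => toQm ((s n).1 i)) (fun i => toQm ((s n).2 i)) := fun n => by
      simp only [toQm_eq, hx, hy]
      obtain ⟨h0, h2⟩ := (hu n).rootY_ne_zero (hn n) (hv n)
      exact obtainedFrom_sol two_ne_zero mm_denom_ne_zero ((hu n).ne_zero (hn n))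
        (hu n).denom_ne_zero (hv n) ((hu n).ratioH_ne_zero (hn n) (hn' n)) (hc n) h0 h2
    refine ⟨s, hs, fun n => ?_, fun n k hnk hsc => ?_⟩
    · obtain ⟨h1, h2⟩ := solution_nontrivial (x := fun i => toPoly ((s n).1 i))
        (y := fun i => toPoly ((s n).2 i)) (hn n) (hn' n) (hu n) (hv n) (hc n) (hx n) (hy n)
      exact ⟨h1, h2, U n, V n, h n, e n, hob n⟩
    · exact hnk (ratioH_injective (hu n) (hu k) (ratioH_eq_of_scalingEquiv (hob n) (hob k) hsc))
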